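/- Let $p$ be a prime, let $\mathbf Q_p\subseteq K\subseteq L\subseteq\overline{\mathbf Q}_p$ with $K,L$ finite over $\mathbf Q_p$, and let $\Gamma_K=G_K/H_K$, where $H_K$ is the kernel of the $p$-adic cyclotomic character of $G_K=\mathrm{Gal}(\overline{\mathbf Q}_p/K)$ (similarly $\Gamma_L$, which is a subgroup of $\Gamma_K$). Let $(R_K,R_L)$ be one of the pairs $(\mathcal E_K,\mathcal E_L)$, $(\mathcal E_K^\dagger,\mathcal E_L^\dagger)$, $(\mathcal R_K,\mathcal R_L)$, where $\mathcal E_K=\mathbf B^{H_K}$ is Fontaine's field, $\mathcal E_K^\dagger$ is its subfield of overconvergent elements and $\mathcal R_K$ is the Robba ring, with their usual commuting actions of $\varphi$ and $\Gamma_K$. A $(\varphi,\Gamma)$-module over $R_L$ is a finite free $R_L$-module $D$ with commuting semilinear actions of $\varphi$ and $\Gamma_L$ such that the linearization $\varphi^*D\to D$ is an isomorphism; a generalized $(\varphi,\Gamma)$-module over $\mathcal R_L$ is defined in the same way with "finitely presented" in place of "finite free". The induced module is $$\mathrm{Ind}_L^KD=\{f:\Gamma_K\to D \mid f(hg)=h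 f(g)\ \text{for } h\in\Gamma_L,\ g\in\Gamma_K\},$$ with $(af)(g)=g(a)f(g)$ for $a\in R_K$, $(\varphi f)(g)=\varphi(f(g))$ and $(\gamma f)(g)=f(g\gamma)$ for $\gamma\in\Gamma_K$. Let $\Delta_K\subseteq\Gamma_K$ be a finite (i.e. torsion) subgroup and $\gamma_K\in\Gamma_K$ an element whose image is a topological generator of $\Gamma_K/\Delta_K$. Put $\Delta_L=\Gamma_L\cap\Delta_K$ and $m=[\Gamma_K:\Gamma_L\Delta_K]$, and let $\gamma_L\in\Gamma_L$ be an element of $\gamma_K^m\Delta_K$ (a topological generator of $\Gamma_L/\Delta_L$). For a module $M$ with commuting semilinear actions of $\varphi$ and $\Gamma=\Gamma_K$ (or $\Gamma_L$), with $(\Delta,\gamma)=(\Delta_K,\gamma_K)$ (resp. $(\Delta_L,\gamma_L)$) and $M'=M^{\Delta}$, let $H^i(M)$ be the cohomology of $$0\to M'\xrightarrow{d_1}M'\oplus M'\xrightarrow{d_2}M'\to0,\qquad d_1(x)=((\gamma-1)x,(\varphi-1)x),\quad d_2(x,y)=(\varphi-1)x-(\gamma-1)y .$$ The cup products $H^i(M)\times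 H^j(N)\to H^{i+j}(M\otimes N)$ are given by $(x,y)\mapsto x\otimes y$ for $(i,j)=(0,0)$ and $(0,2)$, by $(x,(y,z))\mapsto(x\otimes y,x\otimes z)$ for $(0,1)$, and by $((x,y),(z,t))\mapsto y\otimes\varphi(z)-x\otimes\gamma(t)$ for $(1,1)$. **Theorem (Shapiro's lemma).** For all $(\varphi,\Gamma)$-modules $D$ over $R_L$ there are $\mathbf Q_p$-linear isomorphisms $$H^i(D)\cong H^i(\mathrm{Ind}_L^KD)\qquad(i=0,1,2),$$ which are functorial in $D$ and compatible with the cup products, i.e. they carry the cup product $H^i(D)\times H^j(E)\to H^{i+j}(D\otimes E)$ to the cup product of $\mathrm{Ind}_L^KD$ and $\mathrm{Ind}_L^KE$ followed by the map induced by $\mathrm{Ind}_L^KD\otimes_{R_K}\mathrm{Ind}_L^KE\to\mathrm{Ind}_L^K(D\otimes_{R_L}E)$, $(u\otimes v)(g)=u(g)\otimes v(g)$. The same holds for all generalized $(\varphi,\Gamma)$-modules $D$ over $\mathcal R_L$. -/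

import Mathlib

open scoped TensorProduct NNReal

universe u

/-! ## `(φ, Γ)`-rings and modules with semilinear `φ`- and `Γ`-actions -/

/-- A commutative `ℚ_p`-algebra with an endomorphism `φ` and a commuting action of `Γ`. -/
structure PhiGammaRing (p : ℕ) [Fact p.Prime] (Γ : Type) [CommGroup Γ] where
  carrier : Type
  [commRing : CommRing carrier]
  [algebra : Algebra ℚ_[p] carrier]
  frob : carrier →ₐ[ℚ_[p]] carrier
  act : Γ →* (carrier →ₐ[ℚ_[p]] carrier)
  act_frob : ∀ g a, act g (frob a) = frob (act g a)

attribute [instance] PhiGammaRing.commRing PhiGammaRing.algebra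

section Linearization

variable {R S : Type*} [CommRing R] [CommRing S] [Algebra R S]
  {M M' : Type*} [AddCommGroup M] [Module R M] [AddCommGroup M'] [Module S M']

/-- The linearization `S ⊗_R M → M'`, `s ⊗ m ↦ s • f m`, of a semilinear map `f : M → M'`. -/
noncomputable def linearization (f : M →ₛₗ[algebraMap R S] M') : S ⊗[R] M →+ M' :=
  TensorProduct.liftAddHom
    { toFun := fun s =>
        { toFun := fun m => s • f m
          map_zero' := by simp
          map_add' := by simp }
      map_zero' := by ext; simp
      map_add' := by intros; ext; simp [add_smul] }
    (by
      intro r s m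
      change (r • s) • f m = s • f (r • m)
      rw [map_smulₛₗ, smul_smul, Algebra.smul_def, mul_comm])

theorem linearization_tmul (f : M →ₛₗ[algebraMap R S] M') (s : S) (m : M) :
    linearization f (s ⊗ₜ m) = s • f m := rfl

noncomputable def linearizationEquiv (f : M →ₛₗ[algebraMap R S] M')
    (hf : Function.Bijective (linearization f)) : (S ⊗[R] M) ≃ₗ[S] M' :=
  { AddEquiv.ofBijective (linearization f) hf with
    map_smul' := by
      intro s x
      change linearization f (s • x) = s • linearization f x
      induction x with
      | zero => simp
      | tmul t m => simp [TensorProduct.smul_tmul', linearization_tmul, mul_smul]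
      | add x y hx hy => simp [smul_add, hx, hy] }

variable {N N' : Type*} [AddCommGroup N] [Module R N] [AddCommGroup N'] [Module S N']

theorem linearization_tensor (f : M →ₛₗ[algebraMap R S] M') (g : N →ₛₗ[algebraMap R S] N')
    (hf : Function.Bijective (linearization f)) (hg : Function.Bijective (linearization g)) :
    Function.Bijective (linearization (TensorProduct.map f g)) := by
  let e : (S ⊗[R] (M ⊗[R] N)) ≃ₗ[S] (M' ⊗[S] N') :=
    (TensorProduct.AlgebraTensorModule.distribBaseChange R S M N).trans
      (TensorProduct.congr (linearizationEquiv f hf) (linearizationEquiv g hg))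
  have h : ∀ x, linearization (TensorProduct.map f g) x = e x := by
    intro x
    induction x with
    | zero => simp
    | add x y hx hy => simp only [map_add, hx, hy]
    | tmul s y =>
      induction y with
      | zero => simp
      | add x y hx hy => simp only [TensorProduct.tmul_add, map_add, hx, hy]
      | tmul m n =>
        simp only [linearization_tmul, TensorProduct.map_tmul, e, LinearEquiv.trans_apply,
          TensorProduct.AlgebraTensorModule.distribBaseChange_tmul, TensorProduct.congr_tmul]
        change _ = (linearization f (s ⊗ₜ m)) ⊗ₜ[S] (linearization g (1 ⊗ₜ n))
        simp [linearization_tmul, TensorProduct.smul_tmul']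
  rw [show (linearization (TensorProduct.map f g) : _ → _) = e from funext h]
  exact e.bijective

end Linearization

theorem finitePresentation_tensor {R M N : Type*} [CommRing R] [AddCommGroup M] [Module R M]
    [AddCommGroup N] [Module R N] [Module.FinitePresentation R M]
    [Module.FinitePresentation R N] : Module.FinitePresentation R (M ⊗[R] N) := by
  classical
  obtain ⟨n, f, hf⟩ := Module.Finite.exists_fin' R N
  have hk : (LinearMap.ker f).FG := Module.FinitePresentation.fg_ker f hf
  have h1 : Module.FinitePresentation R (M ⊗[R] (Fin n → R)) :=
    Module.FinitePresentation.of_equiv (TensorProduct.piScalarRight R R M (Fin n)).symm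
  refine Module.finitePresentation_of_surjective (f.lTensor M)
    (LinearMap.lTensor_surjective M hf) ?_
  have hex := lTensor_exact M (LinearMap.exact_subtype_ker_map f) hf
  rw [LinearMap.exact_iff.mp hex]
  have : Module.Finite R (LinearMap.ker f) := Module.Finite.iff_fg.mpr hk
  rw [LinearMap.range_eq_map]
  exact Module.Finite.fg_top.map _

section Spaces

variable {p : ℕ} [Fact p.Prime] {Γ Γ' : Type} [CommGroup Γ] [CommGroup Γ']

/-- A module over a `(φ, Γ)`-ring with commuting semilinear `φ` and `Γ`-action
(no finiteness, and no condition on the linearization of `φ`). -/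
structure PhiGammaSpace (R : PhiGammaRing p Γ) where
  carrier : Type u
  [addCommGroup : AddCommGroup carrier]
  [module : Module R.carrier carrier]
  frob : carrier →ₛₗ[(R.frob : R.carrier →+* R.carrier)] carrier
  act : Γ →* AddMonoid.End carrier
  act_smul : ∀ g (a : R.carrier) x, act g (a • x) = R.act g a • act g x
  act_frob : ∀ g x, act g (frob x) = frob (act g x)

attribute [instance] PhiGammaSpace.addCommGroup PhiGammaSpace.module

namespace PhiGammaSpace

variable {R : PhiGammaRing p Γ}

/-- Such a module is a `ℚ_p`-vector space through `ℚ_p → R`. -/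
noncomputable instance (D : PhiGammaSpace.{u} R) : Module ℚ_[p] D.carrier :=
  Module.compHom D.carrier (algebraMap ℚ_[p] R.carrier)

theorem qp_smul (D : PhiGammaSpace.{u} R) (c : ℚ_[p]) (x : D.carrier) :
    c • x = algebraMap ℚ_[p] R.carrier c • x := rfl

/-- The condition `φ^* D ≅ D`: the linearization `R ⊗_{φ, R} D → D`, `a ⊗ x ↦ a φ(x)`,
is bijective. -/
def FrobBijective (D : PhiGammaSpace.{u} R) : Prop :=
  Function.Bijective (@linearization R.carrier R.carrier _ _
    (R.frob : R.carrier →+* R.carrier).toAlgebra D.carrier D.carrier _ _ _ _ D.frob)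

/-- `(φ, Γ)`-modules over `R`: finite free, with `φ^* D ≅ D`. -/
structure IsPhiGammaModule (D : PhiGammaSpace.{u} R) : Prop where
  finite : Module.Finite R.carrier D.carrier
  free : Module.Free R.carrier D.carrier
  frob_bijective : D.FrobBijective

/-- Generalized `(φ, Γ)`-modules over `R`: finitely presented, with `φ^* D ≅ D`. -/
structure IsGeneralizedPhiGammaModule (D : PhiGammaSpace.{u} R) : Prop where
  finitePresentation : Module.FinitePresentation R.carrier D.carrier
  frob_bijective : D.FrobBijective

/-- Morphisms: `R`-linear maps commuting with `φ` and `Γ`. -/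
structure Hom (D E : PhiGammaSpace.{u} R) where
  toLinearMap : D.carrier →ₗ[R.carrier] E.carrier
  map_frob : ∀ x, toLinearMap (D.frob x) = E.frob (toLinearMap x)
  map_act : ∀ g x, toLinearMap (D.act g x) = E.act g (toLinearMap x)

/-- `Γ` acts by semilinear maps. -/
def actₛₗ (D : PhiGammaSpace.{u} R) (g : Γ) :
    D.carrier →ₛₗ[(R.act g : R.carrier →+* R.carrier)] D.carrier :=
  { D.act g with map_smul' := D.act_smul g }

/-- The tensor product over `R`, with the diagonal `φ` and `Γ`-action. -/
noncomputable def tensor (D E : PhiGammaSpace.{u} R) : PhiGammaSpace.{u} R where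
  carrier := D.carrier ⊗[R.carrier] E.carrier
  frob := TensorProduct.map D.frob E.frob
  act :=
    { toFun := fun g => (TensorProduct.map (D.actₛₗ g) (E.actₛₗ g)).toAddMonoidHom
      map_one' := by
        ext x
        change TensorProduct.map (D.actₛₗ 1) (E.actₛₗ 1) x = x
        induction x with
        | zero => simp
        | add x y hx hy => rw [map_add, hx, hy]
        | tmul x y =>
          change D.act 1 x ⊗ₜ[R.carrier] E.act 1 y = _
          simp
      map_mul' := by
        intro g h
        ext x
        change TensorProduct.map (D.actₛₗ (g * h)) (E.actₛₗ (g * h)) x =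
          TensorProduct.map (D.actₛₗ g) (E.actₛₗ g) (TensorProduct.map (D.actₛₗ h) (E.actₛₗ h) x)
        induction x with
        | zero => simp
        | add x y hx hy => simp only [map_add, hx, hy]
        | tmul x y =>
          change D.act (g * h) x ⊗ₜ[R.carrier] E.act (g * h) y =
            D.act g (D.act h x) ⊗ₜ[R.carrier] E.act g (E.act h y)
          simp }
  act_smul := fun g a x => (TensorProduct.map (D.actₛₗ g) (E.actₛₗ g)).map_smulₛₗ a x
  act_frob := by
    intro g x
    change TensorProduct.map (D.actₛₗ g) (E.actₛₗ g) (TensorProduct.map D.frob E.frob x) =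
      TensorProduct.map D.frob E.frob (TensorProduct.map (D.actₛₗ g) (E.actₛₗ g) x)
    induction x with
    | zero => simp
    | add x y hx hy => simp only [map_add, hx, hy]
    | tmul x y =>
      change D.act g (D.frob x) ⊗ₜ[R.carrier] E.act g (E.frob y) =
        D.frob (D.act g x) ⊗ₜ[R.carrier] E.frob (E.act g y)
      rw [D.act_frob, E.act_frob]

/-- The class `x ⊗ y` in the tensor product. -/
noncomputable def tmul {D E : PhiGammaSpace.{u} R} (x : D.carrier) (y : E.carrier) :
    (D.tensor E).carrier :=
  TensorProduct.tmul R.carrier x y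

theorem IsPhiGammaModule.tensor {D E : PhiGammaSpace.{u} R} (hD : D.IsPhiGammaModule)
    (hE : E.IsPhiGammaModule) : (D.tensor E).IsPhiGammaModule := by
  have := hD.finite
  have := hD.free
  have := hE.finite
  have := hE.free
  refine ⟨?_, ?_, ?_⟩
  · change Module.Finite R.carrier (D.carrier ⊗[R.carrier] E.carrier)
    infer_instance
  · change Module.Free R.carrier (D.carrier ⊗[R.carrier] E.carrier)
    infer_instance
  · exact @linearization_tensor R.carrier R.carrier _ _
      (R.frob : R.carrier →+* R.carrier).toAlgebra D.carrier D.carrier _ _ _ _ E.carrier E.carrier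
      _ _ _ _ D.frob E.frob hD.frob_bijective hE.frob_bijective

theorem IsGeneralizedPhiGammaModule.tensor {D E : PhiGammaSpace.{u} R}
    (hD : D.IsGeneralizedPhiGammaModule) (hE : E.IsGeneralizedPhiGammaModule) :
    (D.tensor E).IsGeneralizedPhiGammaModule := by
  have := hD.finitePresentation
  have := hE.finitePresentation
  refine ⟨?_, ?_⟩
  · change Module.FinitePresentation R.carrier (D.carrier ⊗[R.carrier] E.carrier)
    exact finitePresentation_tensor
  · exact @linearization_tensor R.carrier R.carrier _ _
      (R.frob : R.carrier →+* R.carrier).toAlgebra D.carrier D.carrier _ _ _ _ E.carrier E.carrier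
      _ _ _ _ D.frob E.frob hD.frob_bijective hE.frob_bijective

/-! ### The complex `C_{φ,γ}` and its cohomology -/

/-- `φ` as a `ℚ_p`-linear map. -/
noncomputable def frobQ (D : PhiGammaSpace.{u} R) : D.carrier →ₗ[ℚ_[p]] D.carrier where
  toFun := D.frob
  map_add' := map_add D.frob
  map_smul' := by
    intro c x
    simp only [qp_smul, map_smulₛₗ, RingHom.id_apply]
    congr 1
    exact R.frob.commutes c

/-- The action of `g ∈ Γ` as a `ℚ_p`-linear map. -/
noncomputable def actQ (D : PhiGammaSpace.{u} R) (g : Γ) : D.carrier →ₗ[ℚ_[p]] D.carrier where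
  toFun := D.act g
  map_add' := map_add (D.act g)
  map_smul' := by
    intro c x
    simp only [qp_smul, D.act_smul, RingHom.id_apply]
    congr 1
    exact (R.act g).commutes c

/-- `D' = D^Δ`. -/
noncomputable def invariants (D : PhiGammaSpace.{u} R) (Δ : Subgroup Γ) :
    Submodule ℚ_[p] D.carrier where
  carrier := {x | ∀ δ ∈ Δ, D.act δ x = x}
  zero_mem' := by simp
  add_mem' := by
    intro x y hx hy δ hδ
    rw [map_add, hx δ hδ, hy δ hδ]
  smul_mem' := by
    intro c x hx δ hδ
    have := (D.actQ δ).map_smul c x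
    change D.act δ (c • x) = c • D.act δ x at this
    rw [this, hx δ hδ]

/-- `φ` on `D'`. -/
noncomputable def frob' (D : PhiGammaSpace.{u} R) (Δ : Subgroup Γ) :
    D.invariants Δ →ₗ[ℚ_[p]] D.invariants Δ :=
  D.frobQ.restrict (by
    intro x hx δ hδ
    change D.act δ (D.frob x) = D.frob x
    rw [D.act_frob, hx δ hδ])

/-- `γ` on `D'`. -/
noncomputable def act' (D : PhiGammaSpace.{u} R) (Δ : Subgroup Γ) (γ : Γ) :
    D.invariants Δ →ₗ[ℚ_[p]] D.invariants Δ :=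
  (D.actQ γ).restrict (by
    intro x hx δ hδ
    change (D.act δ * D.act γ) x = D.act γ x
    rw [← map_mul, mul_comm, map_mul]
    exact congrArg (D.act γ) (hx δ hδ))

/-- `d₁ x = ((γ - 1) x, (φ - 1) x)`. -/
noncomputable def d₁ (D : PhiGammaSpace.{u} R) (Δ : Subgroup Γ) (γ : Γ) :
    D.invariants Δ →ₗ[ℚ_[p]] D.invariants Δ × D.invariants Δ :=
  (D.act' Δ γ - LinearMap.id).prod (D.frob' Δ - LinearMap.id)

/-- `d₂ (x, y) = (φ - 1) x - (γ - 1) y`. -/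
noncomputable def d₂ (D : PhiGammaSpace.{u} R) (Δ : Subgroup Γ) (γ : Γ) :
    D.invariants Δ × D.invariants Δ →ₗ[ℚ_[p]] D.invariants Δ :=
  (D.frob' Δ - LinearMap.id) ∘ₗ LinearMap.fst _ _ _ -
    (D.act' Δ γ - LinearMap.id) ∘ₗ LinearMap.snd _ _ _

theorem d₂_comp_d₁ (D : PhiGammaSpace.{u} R) (Δ : Subgroup Γ) (γ : Γ) :
    D.d₂ Δ γ ∘ₗ D.d₁ Δ γ = 0 := by
  ext x
  change (D.frob (D.act γ x - x) - (D.act γ x - x)) - (D.act γ (D.frob x - x) - (D.frob x - x))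
    = (0 : D.carrier)
  rw [map_sub, map_sub, D.act_frob]
  abel

/-- `H⁰`, the kernel of `d₁`. -/
abbrev H0 (D : PhiGammaSpace.{u} R) (Δ : Subgroup Γ) (γ : Γ) : Type u :=
  LinearMap.ker (D.d₁ Δ γ)

/-- The `1`-cocycles. -/
abbrev Z1 (D : PhiGammaSpace.{u} R) (Δ : Subgroup Γ) (γ : Γ) : Type u :=
  LinearMap.ker (D.d₂ Δ γ)

/-- The `1`-coboundaries inside the `1`-cocycles. -/
noncomputable abbrev B1 (D : PhiGammaSpace.{u} R) (Δ : Subgroup Γ) (γ : Γ) :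
    Submodule ℚ_[p] (D.Z1 Δ γ) :=
  (LinearMap.range (D.d₁ Δ γ)).submoduleOf (LinearMap.ker (D.d₂ Δ γ))

/-- `H¹ = ker d₂ / im d₁`. -/
abbrev H1 (D : PhiGammaSpace.{u} R) (Δ : Subgroup Γ) (γ : Γ) : Type u :=
  D.Z1 Δ γ ⧸ D.B1 Δ γ

/-- `H² = D' / im d₂`. -/
abbrev H2 (D : PhiGammaSpace.{u} R) (Δ : Subgroup Γ) (γ : Γ) : Type u :=
  D.invariants Δ ⧸ LinearMap.range (D.d₂ Δ γ)

namespace Hom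

variable {D E : PhiGammaSpace.{u} R} (f : Hom D E) (Δ : Subgroup Γ) (γ : Γ)

/-- The map `D' → E'`. -/
noncomputable def map' : D.invariants Δ →ₗ[ℚ_[p]] E.invariants Δ where
  toFun x := ⟨f.toLinearMap x, fun δ hδ => by rw [← f.map_act, x.2 δ hδ]⟩
  map_add' x y := Subtype.ext (map_add f.toLinearMap x.1 y.1)
  map_smul' c x := Subtype.ext (map_smul f.toLinearMap (algebraMap ℚ_[p] R.carrier c) x.1)

theorem map'_d₁ (x : D.invariants Δ) :
    E.d₁ Δ γ (f.map' Δ x) = (f.map' Δ).prodMap (f.map' Δ) (D.d₁ Δ γ x) := by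
  refine Prod.ext (Subtype.ext ?_) (Subtype.ext ?_)
  · change E.act γ (f.toLinearMap x) - f.toLinearMap x = f.toLinearMap (D.act γ x - x)
    rw [map_sub, f.map_act]
  · change E.frob (f.toLinearMap x) - f.toLinearMap x = f.toLinearMap (D.frob x - x)
    rw [map_sub, f.map_frob]

theorem map'_d₂ (x : D.invariants Δ × D.invariants Δ) :
    E.d₂ Δ γ ((f.map' Δ).prodMap (f.map' Δ) x) = f.map' Δ (D.d₂ Δ γ x) := by
  refine Subtype.ext ?_
  change (E.frob (f.toLinearMap x.1) - f.toLinearMap x.1) -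
    (E.act γ (f.toLinearMap x.2) - f.toLinearMap x.2) =
      f.toLinearMap ((D.frob x.1 - x.1) - (D.act γ x.2 - x.2))
  rw [map_sub, map_sub, map_sub, f.map_frob, f.map_act]

/-- Functoriality of `H⁰`. -/
noncomputable def mapH0 : D.H0 Δ γ →ₗ[ℚ_[p]] E.H0 Δ γ :=
  (f.map' Δ).restrict (by
    intro x hx
    rw [LinearMap.mem_ker] at hx ⊢
    rw [f.map'_d₁, hx, map_zero])

/-- The map on `1`-cocycles. -/
noncomputable def mapZ1 : D.Z1 Δ γ →ₗ[ℚ_[p]] E.Z1 Δ γ :=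
  ((f.map' Δ).prodMap (f.map' Δ)).restrict (by
    intro x hx
    rw [LinearMap.mem_ker] at hx ⊢
    rw [f.map'_d₂, hx, map_zero])

/-- Functoriality of `H¹`. -/
noncomputable def mapH1 : D.H1 Δ γ →ₗ[ℚ_[p]] E.H1 Δ γ :=
  Submodule.mapQ _ _ (f.mapZ1 Δ γ) (by
    rintro x ⟨y, hy⟩
    exact ⟨f.map' Δ y, by rw [f.map'_d₁, hy]; rfl⟩)

/-- Functoriality of `H²`. -/
noncomputable def mapH2 : D.H2 Δ γ →ₗ[ℚ_[p]] E.H2 Δ γ :=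
  Submodule.mapQ _ _ (f.map' Δ) (by
    rintro x ⟨y, rfl⟩
    exact ⟨_, f.map'_d₂ Δ γ y⟩)

end Hom

/-! ### Cup products -/

section Cup

variable (D E : PhiGammaSpace.{u} R) (Δ : Subgroup Γ) (γ : Γ)

/-- The pairing `D' × E' → (D ⊗ E)'`, `(x, y) ↦ x ⊗ y`. -/
noncomputable def tmul' :
    D.invariants Δ →ₗ[ℚ_[p]] E.invariants Δ →ₗ[ℚ_[p]] (D.tensor E).invariants Δ :=
  LinearMap.mk₂ ℚ_[p]
    (fun x y => ⟨tmul x.1 y.1, fun δ hδ => by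
      change TensorProduct.tmul R.carrier (D.act δ x) (E.act δ y) = _
      rw [x.2 δ hδ, y.2 δ hδ]; rfl⟩)
    (fun x x' y => Subtype.ext (TensorProduct.add_tmul x.1 x'.1 y.1))
    (fun c x y => Subtype.ext (TensorProduct.smul_tmul' (algebraMap ℚ_[p] R.carrier c) x.1 y.1).symm)
    (fun x y y' => Subtype.ext (TensorProduct.tmul_add x.1 y.1 y'.1))
    (fun c x y => Subtype.ext (TensorProduct.tmul_smul (algebraMap ℚ_[p] R.carrier c) x.1 y.1))

theorem frob'_tmul' (x : D.invariants Δ) (y : E.invariants Δ) :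
    (D.tensor E).frob' Δ (tmul' D E Δ x y) = tmul' D E Δ (D.frob' Δ x) (E.frob' Δ y) := rfl

theorem act'_tmul' (x : D.invariants Δ) (y : E.invariants Δ) :
    (D.tensor E).act' Δ γ (tmul' D E Δ x y) = tmul' D E Δ (D.act' Δ γ x) (E.act' Δ γ y) := rfl

theorem d₁_apply (x : D.invariants Δ) : D.d₁ Δ γ x = (D.act' Δ γ x - x, D.frob' Δ x - x) := rfl

theorem d₂_apply (x : D.invariants Δ × D.invariants Δ) :
    D.d₂ Δ γ x = (D.frob' Δ x.1 - x.1) - (D.act' Δ γ x.2 - x.2) := rfl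

theorem mem_H0 {x : D.invariants Δ} (hx : x ∈ LinearMap.ker (D.d₁ Δ γ)) :
    D.act' Δ γ x = x ∧ D.frob' Δ x = x := by
  rw [LinearMap.mem_ker, d₁_apply, Prod.mk_eq_zero, sub_eq_zero, sub_eq_zero] at hx
  exact hx

/-- `H⁰ × H⁰ → H⁰`, `(x, y) ↦ x ⊗ y`. -/
noncomputable def cup00 : D.H0 Δ γ →ₗ[ℚ_[p]] E.H0 Δ γ →ₗ[ℚ_[p]] (D.tensor E).H0 Δ γ :=
  LinearMap.mk₂ ℚ_[p]
    (fun x y => ⟨tmul' D E Δ x.1 y.1, by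
      obtain ⟨h1, h2⟩ := D.mem_H0 Δ γ x.2
      obtain ⟨h3, h4⟩ := E.mem_H0 Δ γ y.2
      rw [LinearMap.mem_ker, d₁_apply, frob'_tmul', act'_tmul', h1, h2, h3, h4, sub_self]
      rfl⟩)
    (fun x x' y => Subtype.ext (LinearMap.map_add₂ (tmul' D E Δ) x.1 x'.1 y.1))
    (fun c x y => Subtype.ext (LinearMap.map_smul₂ (tmul' D E Δ) c x.1 y.1))
    (fun x y y' => Subtype.ext (map_add (tmul' D E Δ x.1) y.1 y'.1))
    (fun c x y => Subtype.ext (map_smul (tmul' D E Δ x.1) c y.1))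

/-- `(x, (y, z)) ↦ (x ⊗ y, x ⊗ z)` on `H⁰` and cocycles. -/
noncomputable def cup01Z : D.H0 Δ γ →ₗ[ℚ_[p]] E.Z1 Δ γ →ₗ[ℚ_[p]] (D.tensor E).Z1 Δ γ :=
  LinearMap.mk₂ ℚ_[p]
    (fun x y => ⟨(tmul' D E Δ x.1 y.1.1, tmul' D E Δ x.1 y.1.2), by
      obtain ⟨h1, h2⟩ := D.mem_H0 Δ γ x.2
      have hy := y.2
      rw [LinearMap.mem_ker, d₂_apply] at hy ⊢
      have e1 := frob'_tmul' D E Δ x.1 y.1.1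
      have e2 := act'_tmul' D E Δ γ x.1 y.1.2
      rw [h2] at e1
      rw [h1] at e2
      rw [e1, e2, ← map_sub, ← map_sub, ← map_sub, hy, map_zero]⟩)
    (fun x x' y => Subtype.ext (Prod.ext (LinearMap.map_add₂ (tmul' D E Δ) x.1 x'.1 y.1.1)
      (LinearMap.map_add₂ (tmul' D E Δ) x.1 x'.1 y.1.2)))
    (fun c x y => Subtype.ext (Prod.ext (LinearMap.map_smul₂ (tmul' D E Δ) c x.1 y.1.1)
      (LinearMap.map_smul₂ (tmul' D E Δ) c x.1 y.1.2)))
    (fun x y y' => Subtype.ext (Prod.ext (map_add (tmul' D E Δ x.1) y.1.1 y'.1.1)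
      (map_add (tmul' D E Δ x.1) y.1.2 y'.1.2)))
    (fun c x y => Subtype.ext (Prod.ext (map_smul (tmul' D E Δ x.1) c y.1.1)
      (map_smul (tmul' D E Δ x.1) c y.1.2)))

/-- `H⁰ × H¹ → H¹`, `(x, (y, z)) ↦ (x ⊗ y, x ⊗ z)`. -/
noncomputable def cup01 : D.H0 Δ γ →ₗ[ℚ_[p]] E.H1 Δ γ →ₗ[ℚ_[p]] (D.tensor E).H1 Δ γ :=
  (Submodule.liftQ _ ((cup01Z D E Δ γ).compr₂ (Submodule.mkQ _)).flip (by
    rintro y ⟨w, hw⟩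
    rw [LinearMap.mem_ker]
    ext1 x
    obtain ⟨h1, h2⟩ := D.mem_H0 Δ γ x.2
    refine (Submodule.Quotient.mk_eq_zero _).mpr ⟨tmul' D E Δ x.1 w, ?_⟩
    change _ = (tmul' D E Δ x.1 y.1.1, tmul' D E Δ x.1 y.1.2)
    change _ = y.1 at hw
    rw [← hw, d₁_apply, d₁_apply, frob'_tmul', act'_tmul', h1, h2, map_sub, map_sub])).flip

/-- `H⁰ × H² → H²`, `(x, y) ↦ x ⊗ y`. -/
noncomputable def cup02 : D.H0 Δ γ →ₗ[ℚ_[p]] E.H2 Δ γ →ₗ[ℚ_[p]] (D.tensor E).H2 Δ γ :=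
  (Submodule.liftQ _ (((tmul' D E Δ).domRestrict _).compr₂ (Submodule.mkQ _)).flip (by
    rintro y ⟨w, rfl⟩
    rw [LinearMap.mem_ker]
    ext1 x
    obtain ⟨h1, h2⟩ := D.mem_H0 Δ γ x.2
    refine (Submodule.Quotient.mk_eq_zero _).mpr ⟨(tmul' D E Δ x.1 w.1, tmul' D E Δ x.1 w.2), ?_⟩
    change _ = tmul' D E Δ x.1 _
    rw [d₂_apply, d₂_apply, frob'_tmul', act'_tmul', h1, h2, map_sub, map_sub, map_sub])).flip

/-- `((x, y), (z, t)) ↦ y ⊗ φ(z) - x ⊗ γ(t)` on cocycles. -/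
noncomputable def cup11Z : D.Z1 Δ γ →ₗ[ℚ_[p]] E.Z1 Δ γ →ₗ[ℚ_[p]] (D.tensor E).invariants Δ :=
  (tmul' D E Δ).compl₁₂ (LinearMap.snd _ _ _ ∘ₗ Submodule.subtype _)
      (E.frob' Δ ∘ₗ LinearMap.fst _ _ _ ∘ₗ Submodule.subtype _) -
    (tmul' D E Δ).compl₁₂ (LinearMap.fst _ _ _ ∘ₗ Submodule.subtype _)
      (E.act' Δ γ ∘ₗ LinearMap.snd _ _ _ ∘ₗ Submodule.subtype _)

theorem cup11Z_apply (c : D.Z1 Δ γ) (d : E.Z1 Δ γ) : cup11Z D E Δ γ c d =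
    tmul' D E Δ c.1.2 (E.frob' Δ d.1.1) - tmul' D E Δ c.1.1 (E.act' Δ γ d.1.2) := rfl

theorem act'_frob' (x : D.invariants Δ) :
    D.act' Δ γ (D.frob' Δ x) = D.frob' Δ (D.act' Δ γ x) :=
  Subtype.ext (D.act_frob γ x.1)

theorem cup11Z_left (c : D.Z1 Δ γ) (d : E.Z1 Δ γ) (hc : c ∈ D.B1 Δ γ) :
    cup11Z D E Δ γ c d ∈ LinearMap.range ((D.tensor E).d₂ Δ γ) := by
  obtain ⟨w, hw⟩ := hc
  have hd := d.2
  change _ = c.1 at hw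
  rw [LinearMap.mem_ker, d₂_apply, sub_eq_zero] at hd
  refine ⟨(tmul' D E Δ w d.1.1, tmul' D E Δ w d.1.2), ?_⟩
  rw [cup11Z_apply, ← hw, d₁_apply, d₂_apply, frob'_tmul', act'_tmul']
  have h2 : tmul' D E Δ w (E.frob' Δ d.1.1) - tmul' D E Δ w d.1.1 =
      tmul' D E Δ w (E.act' Δ γ d.1.2) - tmul' D E Δ w d.1.2 := by
    rw [← map_sub, hd, map_sub]
  simp only [map_sub, LinearMap.sub_apply]
  refine sub_eq_zero.mp (Eq.trans ?_ (sub_eq_zero.mpr h2))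
  abel

theorem cup11Z_right (c : D.Z1 Δ γ) (d : E.Z1 Δ γ) (hd : d ∈ E.B1 Δ γ) :
    cup11Z D E Δ γ c d ∈ LinearMap.range ((D.tensor E).d₂ Δ γ) := by
  obtain ⟨w, hw⟩ := hd
  have hc := c.2
  change _ = d.1 at hw
  rw [LinearMap.mem_ker, d₂_apply, sub_eq_zero] at hc
  refine ⟨-(tmul' D E Δ c.1.1 (E.act' Δ γ w), tmul' D E Δ c.1.2 (E.frob' Δ w)), ?_⟩
  have h2 : tmul' D E Δ (D.frob' Δ c.1.1) (E.frob' Δ (E.act' Δ γ w)) -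
        tmul' D E Δ c.1.1 (E.frob' Δ (E.act' Δ γ w)) =
      tmul' D E Δ (D.act' Δ γ c.1.2) (E.frob' Δ (E.act' Δ γ w)) -
        tmul' D E Δ c.1.2 (E.frob' Δ (E.act' Δ γ w)) := by
    have := congrArg (fun z => tmul' D E Δ z (E.frob' Δ (E.act' Δ γ w))) hc
    simpa only [map_sub, LinearMap.sub_apply] using this
  rw [map_neg, cup11Z_apply, ← hw, d₁_apply, d₂_apply, frob'_tmul', act'_tmul', act'_frob']
  simp only [map_sub, act'_frob']
  refine sub_eq_zero.mp (Eq.trans ?_ (neg_eq_zero.mpr (sub_eq_zero.mpr h2)))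
  abel

/-- `H¹ × H¹ → H²`, `((x, y), (z, t)) ↦ y ⊗ φ(z) - x ⊗ γ(t)`. -/
noncomputable def cup11 : D.H1 Δ γ →ₗ[ℚ_[p]] E.H1 Δ γ →ₗ[ℚ_[p]] (D.tensor E).H2 Δ γ :=
  Submodule.liftQ _
    (Submodule.liftQ _ ((cup11Z D E Δ γ).compr₂ (Submodule.mkQ _)).flip (by
      intro d hd
      rw [LinearMap.mem_ker]
      ext1 c
      exact (Submodule.Quotient.mk_eq_zero _).mpr (cup11Z_right D E Δ γ c d hd))).flip (by
    intro c hc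
    rw [LinearMap.mem_ker]
    refine LinearMap.ext fun d => ?_
    obtain ⟨d, rfl⟩ := Submodule.mkQ_surjective _ d
    exact (Submodule.Quotient.mk_eq_zero _).mpr (cup11Z_left D E Δ γ c d hc))

end Cup

end PhiGammaSpace
/-! ### Induction along `Γ' → Γ` -/

/-- A homomorphism of coefficient rings `R → R'` over a group homomorphism `ι : Γ' → Γ`,
compatible with `φ` and with the group actions. -/
structure PhiGammaRing.Hom (R : PhiGammaRing p Γ) (R' : PhiGammaRing p Γ') (ι : Γ' →* Γ) where
  toAlgHom : R.carrier →ₐ[ℚ_[p]] R'.carrier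
  map_frob : ∀ a, toAlgHom (R.frob a) = R'.frob (toAlgHom a)
  map_act : ∀ h a, toAlgHom (R.act (ι h) a) = R'.act h (toAlgHom a)

namespace PhiGammaSpace

variable {R : PhiGammaRing p Γ} {R' : PhiGammaRing p Γ'} {ι : Γ' →* Γ}

/-- The functions `f : Γ → D` with `f (h g) = h (f g)` for `h ∈ Γ'`. -/
def indSubgroup (ι : Γ' →* Γ) (D : PhiGammaSpace.{u} R') : AddSubgroup (Γ → D.carrier) where
  carrier := {f | ∀ h g, f (ι h * g) = D.act h (f g)}
  zero_mem' := by simp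
  add_mem' := by
    intro f f' hf hf' h g
    simp only [Pi.add_apply, hf h g, hf' h g, map_add]
  neg_mem' := by
    intro f hf h g
    simp only [Pi.neg_apply, hf h g, map_neg]

/-- The `R`-module structure `(a f)(g) = g(a) f(g)`. -/
@[reducible] noncomputable def indModule (j : R.Hom R' ι) (D : PhiGammaSpace.{u} R') :
    Module R.carrier (indSubgroup ι D) where
  smul a f := ⟨fun g => j.toAlgHom (R.act g a) • f.1 g, fun h g => by
    change j.toAlgHom (R.act (ι h * g) a) • f.1 (ι h * g) =
      D.act h (j.toAlgHom (R.act g a) • f.1 g)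
    rw [f.2 h g, D.act_smul, map_mul, ← j.map_act]; rfl⟩
  one_smul f := Subtype.ext (funext fun g => by
    change j.toAlgHom (R.act g 1) • f.1 g = f.1 g
    simp)
  mul_smul a b f := Subtype.ext (funext fun g => by
    change j.toAlgHom (R.act g (a * b)) • f.1 g =
      j.toAlgHom (R.act g a) • j.toAlgHom (R.act g b) • f.1 g
    rw [map_mul, map_mul, mul_smul])
  smul_zero a := Subtype.ext (funext fun g => by
    change j.toAlgHom (R.act g a) • (0 : D.carrier) = 0
    rw [smul_zero])
  smul_add a f f' := Subtype.ext (funext fun g => by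
    change j.toAlgHom (R.act g a) • (f.1 g + f'.1 g) =
      j.toAlgHom (R.act g a) • f.1 g + j.toAlgHom (R.act g a) • f'.1 g
    rw [smul_add])
  add_smul a b f := Subtype.ext (funext fun g => by
    change j.toAlgHom (R.act g (a + b)) • f.1 g =
      j.toAlgHom (R.act g a) • f.1 g + j.toAlgHom (R.act g b) • f.1 g
    rw [map_add, map_add, add_smul])
  zero_smul f := Subtype.ext (funext fun g => by
    change j.toAlgHom (R.act g 0) • f.1 g = 0
    rw [map_zero, map_zero, zero_smul])

/-- The induced module `Ind D = {f : Γ → D | f (h g) = h (f g) for h ∈ Γ'}`, with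
`(a f)(g) = g(a) f(g)`, `(φ f)(g) = φ(f(g))` and `(γ f)(g) = f(g γ)`. -/
noncomputable def ind (j : R.Hom R' ι) (D : PhiGammaSpace.{u} R') : PhiGammaSpace.{u} R :=
  letI := indModule j D
  { carrier := indSubgroup ι D
    frob :=
      { toFun := fun f => ⟨fun g => D.frob (f.1 g), fun h g =>
          (congrArg D.frob (f.2 h g)).trans (D.act_frob h (f.1 g)).symm⟩
        map_add' := fun f f' => Subtype.ext (funext fun g => map_add D.frob (f.1 g) (f'.1 g))
        map_smul' := fun a f => Subtype.ext (funext fun g => by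
          change D.frob (j.toAlgHom (R.act g a) • f.1 g) =
            j.toAlgHom (R.act g (R.frob a)) • D.frob (f.1 g)
          rw [map_smulₛₗ, R.act_frob, j.map_frob]; rfl) }
    act :=
      { toFun := fun γ =>
          { toFun := fun f => ⟨fun g => f.1 (g * γ), fun h g =>
              (congrArg f.1 (mul_assoc (ι h) g γ)).trans (f.2 h (g * γ))⟩
            map_zero' := rfl
            map_add' := fun _ _ => rfl }
        map_one' := by
          ext f g
          exact congrArg f.1 (mul_one g)
        map_mul' := by
          intro γ γ'
          ext f g
          exact congrArg f.1 (mul_assoc g γ γ').symm }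
    act_smul := fun γ a f => Subtype.ext (funext fun g => by
      change j.toAlgHom (R.act (g * γ) a) • f.1 (g * γ) =
        j.toAlgHom (R.act g (R.act γ a)) • f.1 (g * γ)
      rw [map_mul]; rfl)
    act_frob := fun _ _ => rfl }

/-- Functoriality of induction. -/
noncomputable def Hom.ind (j : R.Hom R' ι) {D E : PhiGammaSpace.{u} R'} (f : Hom D E) :
    Hom (D.ind j) (E.ind j) where
  toLinearMap :=
    { toFun := fun u => ⟨fun g => f.toLinearMap (u.1 g), fun h g =>
        (congrArg f.toLinearMap (u.2 h g)).trans (f.map_act h (u.1 g))⟩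
      map_add' := fun u v => Subtype.ext (funext fun g => map_add f.toLinearMap (u.1 g) (v.1 g))
      map_smul' := fun a u => Subtype.ext (funext fun g =>
        map_smul f.toLinearMap (j.toAlgHom (R.act g a)) (u.1 g)) }
  map_frob := fun u => Subtype.ext (funext fun g => f.map_frob (u.1 g))
  map_act := fun _ _ => rfl

/-- The map `u ⊗ v ↦ (g ↦ u(g) ⊗ v(g))` as an `R`-linear map. -/
noncomputable def indMulₗ (j : R.Hom R' ι) (D E : PhiGammaSpace.{u} R') :
    (D.ind j).carrier ⊗[R.carrier] (E.ind j).carrier →ₗ[R.carrier]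
      ((D.tensor E).ind j).carrier :=
  TensorProduct.lift (LinearMap.mk₂ R.carrier
    (fun (u : (D.ind j).carrier) (v : (E.ind j).carrier) =>
      (⟨fun g => tmul (u.1 g) (v.1 g), fun h g => congrArg₂ tmul (u.2 h g) (v.2 h g)⟩ :
        ((D.tensor E).ind j).carrier))
    (fun _ _ _ => Subtype.ext (funext fun _ => TensorProduct.add_tmul _ _ _))
    (fun _ _ _ => Subtype.ext (funext fun _ => rfl))
    (fun _ _ _ => Subtype.ext (funext fun _ => TensorProduct.tmul_add _ _ _))
    (fun _ _ _ => Subtype.ext (funext fun _ => TensorProduct.tmul_smul _ _ _)))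

/-- The canonical map `Ind D ⊗_R Ind E → Ind (D ⊗_{R'} E)`, `(u ⊗ v)(g) = u(g) ⊗ v(g)`. -/
noncomputable def indMul (j : R.Hom R' ι) (D E : PhiGammaSpace.{u} R') :
    Hom ((D.ind j).tensor (E.ind j)) ((D.tensor E).ind j) where
  toLinearMap := indMulₗ j D E
  map_frob := fun x => by
    change indMulₗ j D E (TensorProduct.map (D.ind j).frob (E.ind j).frob x) =
      ((D.tensor E).ind j).frob (indMulₗ j D E x)
    induction x using TensorProduct.induction_on with
    | zero => simp only [map_zero]
    | add x y hx hy => rw [map_add, map_add, map_add (indMulₗ j D E) x y, map_add, hx, hy]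
    | tmul u v => rfl
  map_act := fun γ x => by
    change indMulₗ j D E (TensorProduct.map ((D.ind j).actₛₗ γ) ((E.ind j).actₛₗ γ) x) =
      ((D.tensor E).ind j).act γ (indMulₗ j D E x)
    induction x using TensorProduct.induction_on with
    | zero => simp only [map_zero]
    | add x y hx hy => rw [map_add, map_add, map_add (indMulₗ j D E) x y, map_add, hx, hy]
    | tmul u v => rfl

end PhiGammaSpace

open PhiGammaSpace in
/-- Isomorphisms `H^i(D) ≅ H^i(Ind D)`, `i = 0, 1, 2`, for all `D` of a class `P` of modules over
`R'` which is stable under tensor products, functorial in `D` and compatible with the cup products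
(through the canonical map `Ind D ⊗ Ind E → Ind (D ⊗ E)`).  The cohomology of `Ind D` is computed
with `(Δ, γ)`, the cohomology of `D` with `(Γ' ∩ Δ, γ')`. -/
structure ShapiroIsomorphisms {R : PhiGammaRing p Γ} {R' : PhiGammaRing p Γ'} {ι : Γ' →* Γ}
    (j : R.Hom R' ι) (Δ : Subgroup Γ) (γ : Γ) (γ' : Γ') (P : PhiGammaSpace.{u} R' → Prop)
    (hP : ∀ D E, P D → P E → P (D.tensor E)) where
  iso0 : ∀ D, P D → (D.H0 (Δ.comap ι) γ' ≃ₗ[ℚ_[p]] (D.ind j).H0 Δ γ)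
  iso1 : ∀ D, P D → (D.H1 (Δ.comap ι) γ' ≃ₗ[ℚ_[p]] (D.ind j).H1 Δ γ)
  iso2 : ∀ D, P D → (D.H2 (Δ.comap ι) γ' ≃ₗ[ℚ_[p]] (D.ind j).H2 Δ γ)
  natural0 : ∀ D E (hD : P D) (hE : P E) (f : Hom D E) (x : D.H0 (Δ.comap ι) γ'),
    iso0 E hE (f.mapH0 _ _ x) = (f.ind j).mapH0 Δ γ (iso0 D hD x)
  natural1 : ∀ D E (hD : P D) (hE : P E) (f : Hom D E) (x : D.H1 (Δ.comap ι) γ'),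
    iso1 E hE (f.mapH1 _ _ x) = (f.ind j).mapH1 Δ γ (iso1 D hD x)
  natural2 : ∀ D E (hD : P D) (hE : P E) (f : Hom D E) (x : D.H2 (Δ.comap ι) γ'),
    iso2 E hE (f.mapH2 _ _ x) = (f.ind j).mapH2 Δ γ (iso2 D hD x)
  cup00 : ∀ D E (hD : P D) (hE : P E) (x : D.H0 (Δ.comap ι) γ') (y : E.H0 (Δ.comap ι) γ'),
    iso0 _ (hP D E hD hE) (D.cup00 E _ _ x y) =
      (indMul j D E).mapH0 Δ γ ((D.ind j).cup00 (E.ind j) Δ γ (iso0 D hD x) (iso0 E hE y))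
  cup01 : ∀ D E (hD : P D) (hE : P E) (x : D.H0 (Δ.comap ι) γ') (y : E.H1 (Δ.comap ι) γ'),
    iso1 _ (hP D E hD hE) (D.cup01 E _ _ x y) =
      (indMul j D E).mapH1 Δ γ ((D.ind j).cup01 (E.ind j) Δ γ (iso0 D hD x) (iso1 E hE y))
  cup02 : ∀ D E (hD : P D) (hE : P E) (x : D.H0 (Δ.comap ι) γ') (y : E.H2 (Δ.comap ι) γ'),
    iso2 _ (hP D E hD hE) (D.cup02 E _ _ x y) =
      (indMul j D E).mapH2 Δ γ ((D.ind j).cup02 (E.ind j) Δ γ (iso0 D hD x) (iso2 E hE y))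
  cup11 : ∀ D E (hD : P D) (hE : P E) (x : D.H1 (Δ.comap ι) γ') (y : E.H1 (Δ.comap ι) γ'),
    iso2 _ (hP D E hD hE) (D.cup11 E _ _ x y) =
      (indMul j D E).mapH2 Δ γ ((D.ind j).cup11 (E.ind j) Δ γ (iso1 D hD x) (iso1 E hE y))

end Spaces

section Rings

variable (p : ℕ) [Fact p.Prime]

/-! ## The period rings -/

/-- `G_{ℚ_p}`, the absolute Galois group of `ℚ_p`. -/
abbrev AbsGal : Type := PadicAlgCl p ≃ₐ[ℚ_[p]] PadicAlgCl p

variable {p} in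
theorem AbsGal.norm_apply (σ : AbsGal p) (x : PadicAlgCl p) : ‖σ x‖ = ‖x‖ :=
  (spectralNorm_eq_of_equiv σ x).symm

variable {p} in
theorem AbsGal.continuous (σ : AbsGal p) : Continuous (σ : PadicAlgCl p →+* PadicAlgCl p) :=
  (AddMonoidHomClass.isometry_of_norm σ σ.norm_apply).continuous

/-- The continuous extension of the Galois action to `ℂ_p`. -/
noncomputable def galComplex : AbsGal p →* (ℂ_[p] →+* ℂ_[p]) where
  toFun σ := UniformSpace.Completion.mapRingHom (σ : PadicAlgCl p →+* PadicAlgCl p) σ.continuous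
  map_one' := UniformSpace.Completion.mapRingHom_id
  map_mul' σ τ := (UniformSpace.Completion.mapRingHom_comp (hg := σ.continuous) (hf := τ.continuous)).symm

theorem norm_galComplex (σ : AbsGal p) (x : ℂ_[p]) : ‖galComplex p σ x‖ = ‖x‖ := by
  induction x using UniformSpace.Completion.induction_on with
  | hp =>
    exact isClosed_eq (continuous_norm.comp UniformSpace.Completion.continuous_map) continuous_norm
  | ih x =>
    change ‖UniformSpace.Completion.mapRingHom (σ : PadicAlgCl p →+* PadicAlgCl p) σ.continuous
      (x : ℂ_[p])‖ = _
    rw [UniformSpace.Completion.mapRingHom_coe σ.continuous]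
    rw [UniformSpace.Completion.norm_coe, UniformSpace.Completion.norm_coe]
    exact σ.norm_apply x

theorem valuation_galComplex (σ : AbsGal p) (x : ℂ_[p]) :
    (PadicComplex.valued p).v (galComplex p σ x) = (PadicComplex.valued p).v x := by
  have h : ∀ y : ℂ_[p], ‖y‖ = ((PadicComplex.valued p).v y : ℝ) := by
    intro y
    rw [PadicComplex.norm_eq_norm, Valuation.norm_def, PadicComplex.RankOne.hom_eq_embedding,
      Valuation.embedding_restrict]
  have := norm_galComplex p σ x
  rw [h, h] at this
  exact_mod_cast this

/-- The Galois action on `𝓞_{ℂ_p}`. -/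
noncomputable def galInt : AbsGal p →* (𝓞_ℂ_[p] →+* 𝓞_ℂ_[p]) where
  toFun σ := (galComplex p σ).restrict 𝓞_ℂ_[p] 𝓞_ℂ_[p] (by
    intro x hx
    change (PadicComplex.valued p).v _ ≤ 1
    rw [valuation_galComplex]
    exact hx)
  map_one' := by
    ext x
    change galComplex p 1 x = x
    rw [map_one]; rfl
  map_mul' σ τ := by
    ext x
    change galComplex p (σ * τ) x = galComplex p σ (galComplex p τ x)
    rw [map_mul]; rfl

instance : Fact (¬ IsUnit (p : 𝓞_ℂ_[p])) := ⟨fun h => by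
  have := (PadicComplexInt.integers p).one_of_isUnit h
  rw [map_natCast, PadicComplex.valuation_p, one_div, inv_eq_one, Nat.cast_eq_one] at this
  exact (Fact.out : p.Prime).ne_one this⟩

/-- `Ẽ⁺`, the perfection of `𝓞_{ℂ_p} / p`. -/
def Etp : Type := PreTilt 𝓞_ℂ_[p] p

noncomputable instance : CommRing (Etp p) := inferInstanceAs (CommRing (PreTilt 𝓞_ℂ_[p] p))
instance : CharP (Etp p) p := inferInstanceAs (CharP (PreTilt 𝓞_ℂ_[p] p) p)
instance : PerfectRing (Etp p) p := inferInstanceAs (PerfectRing (PreTilt 𝓞_ℂ_[p] p) p)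
instance : IsDomain (Etp p) := PreTilt.isDomain _ _ _ (PadicComplexInt.integers p) p

/-- The absolute value `|x| = p ^ (- v_E(x))`, `v_E(x) = v_p(x⁽⁰⁾)`, on `Ẽ⁺`. -/
noncomputable def absEtp : Valuation (Etp p) ℝ≥0 :=
  PreTilt.val _ _ _ (PadicComplexInt.integers p) p

theorem absEtp_eq_zero {x : Etp p} : absEtp p x = 0 ↔ x = 0 :=
  PreTilt.map_eq_zero (PadicComplexInt.integers p)

theorem galInt_span (σ : AbsGal p) :
    Ideal.span {(p : 𝓞_ℂ_[p])} ≤ (Ideal.span {(p : 𝓞_ℂ_[p])}).comap (galInt p σ) := by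
  rw [Ideal.span_le, Set.singleton_subset_iff]
  change galInt p σ (p : 𝓞_ℂ_[p]) ∈ Ideal.span {(p : 𝓞_ℂ_[p])}
  rw [map_natCast]
  exact Ideal.mem_span_singleton_self _

/-- The Galois action on `𝓞_{ℂ_p} / p`. -/
noncomputable def galModP : AbsGal p →* (ModP 𝓞_ℂ_[p] p →+* ModP 𝓞_ℂ_[p] p) where
  toFun σ := Ideal.quotientMap (Ideal.span {(p : 𝓞_ℂ_[p])}) (galInt p σ) (galInt_span p σ)
  map_one' := by
    refine Ideal.Quotient.ringHom_ext (RingHom.ext fun y => ?_)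
    rw [RingHom.comp_apply, Ideal.quotientMap_mk, map_one]
    rfl
  map_mul' σ τ := by
    refine Ideal.Quotient.ringHom_ext (RingHom.ext fun y => ?_)
    rw [RingHom.comp_apply, Ideal.quotientMap_mk, map_mul]
    rfl

/-- The Galois action on `Ẽ⁺`. -/
noncomputable def galEtp : AbsGal p →* (Etp p →+* Etp p) where
  toFun σ := Perfection.map p (galModP p σ)
  map_one' := by rw [map_one]; rfl
  map_mul' σ τ := by rw [map_mul]; rfl

theorem coeff_galEtp (σ : AbsGal p) (x : Etp p) (n : ℕ) :
    PreTilt.coeff n (galEtp p σ x) = galModP p σ (PreTilt.coeff n x) := rfl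

theorem absEtp_galEtp (σ : AbsGal p) (x : Etp p) : absEtp p (galEtp p σ x) = absEtp p x := by
  have hinj : Function.Injective (galEtp p σ) := by
    refine Function.LeftInverse.injective (g := galEtp p σ⁻¹) fun y => ?_
    change (galEtp p σ⁻¹ * galEtp p σ) y = y
    rw [← map_mul, inv_mul_cancel, map_one]
    rfl
  by_cases hx : x = 0
  · rw [hx, map_zero]
  · obtain ⟨n, hn⟩ : ∃ n, PreTilt.coeff n (galEtp p σ x) ≠ 0 := by
      by_contra! h
      exact hx (hinj ((Perfection.ext h : galEtp p σ x = 0).trans (map_zero _).symm))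
    have hn' : PreTilt.coeff n x ≠ 0 := by
      intro h
      rw [coeff_galEtp, h, map_zero] at hn
      exact hn rfl
    refine (PreTilt.valAux_eq (PadicComplexInt.integers p) hn).trans
      (Eq.trans ?_ (PreTilt.valAux_eq (PadicComplexInt.integers p) hn').symm)
    rw [coeff_galEtp] at hn ⊢
    obtain ⟨y, hy⟩ := Ideal.Quotient.mk_surjective (PreTilt.coeff n x)
    rw [← hy] at hn hn' ⊢
    change (Ideal.Quotient.mk _ (galInt p σ y) : ModP 𝓞_ℂ_[p] p) ≠ 0 at hn
    change ModP.preVal _ _ _ _ (Ideal.Quotient.mk _ (galInt p σ y)) ^ _ = _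
    rw [ModP.preVal_mk (PadicComplexInt.integers p) hn,
      ModP.preVal_mk (PadicComplexInt.integers p) hn']
    congr 1
    exact valuation_galComplex p σ y

/-- `ℤ_p(1) ⊆ Ẽ⁺`: the elements given by compatible systems `1, ζ_p, ζ_{p²}, …` of
`p`-power roots of unity. -/
def tateModule : Set (Etp p) :=
  {η | ∃ ζ : ℕ → 𝓞_ℂ_[p], ζ 0 = 1 ∧ (∀ n, ζ (n + 1) ^ p = ζ n) ∧
    ∀ n, PreTilt.coeff n η = Ideal.Quotient.mk _ (ζ n)}

/-- The endomorphisms of `Ẽ⁺` which map `ℤ_p(1)` into itself and raise the absolute value to some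
positive power.  Frobenius and the elements of the Galois group are of this type; all of them act
on the rings below by functoriality. -/
def scalingEnd : Submonoid (Etp p →+* Etp p) where
  carrier := {σ | (∀ η ∈ tateModule p, σ η ∈ tateModule p) ∧
    ∃ c : ℝ, 0 < c ∧ ∀ x, absEtp p (σ x) = absEtp p x ^ c}
  one_mem' := ⟨fun η h => h, 1, one_pos, fun x => (NNReal.rpow_one _).symm⟩
  mul_mem' := by
    rintro σ τ ⟨h1, c, hc, h2⟩ ⟨h3, d, hd, h4⟩
    refine ⟨fun η h => h1 _ (h3 _ h), d * c, mul_pos hd hc, fun x => ?_⟩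
    change absEtp p (σ (τ x)) = _
    rw [h2, h4, NNReal.rpow_mul]

/-- The Galois group, acting on `Ẽ⁺`. -/
noncomputable def galS : AbsGal p →* scalingEnd p :=
  (galEtp p).codRestrict (scalingEnd p) (by
    intro g
    refine ⟨?_, 1, one_pos, fun x => by rw [NNReal.rpow_one, absEtp_galEtp]⟩
    rintro η ⟨ζ, h0, h1, h2⟩
    refine ⟨fun n => galInt p g (ζ n), ?_, ?_, ?_⟩
    · change galInt p g (ζ 0) = 1
      rw [h0, map_one]
    · intro n
      change galInt p g (ζ (n + 1)) ^ p = galInt p g (ζ n)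
      rw [← map_pow, h1]
    · intro n
      rw [coeff_galEtp, h2]
      rfl)

/-- The absolute Frobenius of `Ẽ⁺`. -/
noncomputable def frobS : scalingEnd p :=
  ⟨frobenius (Etp p) p, by
    refine ⟨?_, p, by exact_mod_cast (Fact.out : p.Prime).pos, fun x => ?_⟩
    · rintro η ⟨ζ, h0, h1, h2⟩
      refine ⟨fun n => ζ n ^ p, ?_, ?_, ?_⟩
      · change ζ 0 ^ p = 1
        rw [h0, one_pow]
      · intro n
        exact congrArg (· ^ p) (h1 n)
      · intro n
        refine (map_pow (PreTilt.coeff n) (η : PreTilt 𝓞_ℂ_[p] p) p).trans ?_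
        exact (congrArg (· ^ p) (h2 n)).trans (map_pow (Ideal.Quotient.mk _) (ζ n) p).symm
    · rw [frobenius_def, map_pow, NNReal.rpow_natCast]⟩

theorem frobS_comm (σ : scalingEnd p) : σ * frobS p = frobS p * σ :=
  Subtype.ext (RingHom.ext fun x => map_pow σ.1 x p)

theorem scalingEnd_injective (σ : scalingEnd p) : Function.Injective σ.1 := by
  obtain ⟨-, c, hc, h⟩ := σ.2
  refine (injective_iff_map_eq_zero _).mpr fun x hx => ?_
  have := h x
  rw [hx, map_zero, eq_comm, NNReal.rpow_eq_zero_iff] at this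
  exact (absEtp_eq_zero p).mp this.1

/-- `Ẽ`, the fraction field of `Ẽ⁺`. -/
def Et : Type := FractionRing (Etp p)

noncomputable instance : Field (Et p) := inferInstanceAs (Field (FractionRing (Etp p)))
noncomputable instance : Algebra (Etp p) (Et p) :=
  inferInstanceAs (Algebra (Etp p) (FractionRing (Etp p)))
instance : IsFractionRing (Etp p) (Et p) :=
  inferInstanceAs (IsFractionRing (Etp p) (FractionRing (Etp p)))
instance : CharP (Et p) p :=
  charP_of_injective_algebraMap (IsFractionRing.injective (Etp p) (Et p)) p

instance : PerfectRing (Et p) p := by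
  refine PerfectRing.ofSurjective _ p fun x => ?_
  obtain ⟨a, b, hb, rfl⟩ := IsFractionRing.div_surjective (A := Etp p) x
  obtain ⟨a', rfl⟩ := surjective_frobenius (Etp p) p a
  obtain ⟨b', rfl⟩ := surjective_frobenius (Etp p) p b
  exact ⟨algebraMap _ _ a' / algebraMap _ _ b', by simp only [frobenius_def, div_pow, map_pow]⟩

/-- The absolute value `|x| = p ^ (- v_E(x))` on `Ẽ`. -/
noncomputable def absEt : Valuation (Et p) ℝ≥0 :=
  (absEtp p).extendToLocalization (S := nonZeroDivisors (Etp p))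
    (fun _ hx h => nonZeroDivisors.ne_zero hx ((absEtp_eq_zero p).mp h)) (Et p)

theorem absEt_algebraMap (x : Etp p) : absEt p (algebraMap _ _ x) = absEtp p x :=
  Valuation.extendToLocalization_apply_map_apply _ _ _ _

theorem fracMap_algebraMap {A B F G : Type} [CommRing A] [CommRing B] [Field F] [Field G]
    [Algebra A F] [Algebra B G] [IsDomain A] [IsDomain B] [IsFractionRing A F] [IsFractionRing B G]
    {f : A →+* B} (hf : Function.Injective f) (x : A) :
    (IsFractionRing.map hf : F →+* G) (algebraMap A F x) = algebraMap B G (f x) :=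
  IsLocalization.map_eq _ x

/-- The extension of an endomorphism to the fraction field. -/
noncomputable def actEtHom (σ : scalingEnd p) : Et p →+* Et p :=
  IsFractionRing.map (scalingEnd_injective p σ)

theorem actEtHom_algebraMap (σ : scalingEnd p) (x : Etp p) :
    actEtHom p σ (algebraMap _ _ x) = algebraMap _ _ (σ.1 x) :=
  fracMap_algebraMap (scalingEnd_injective p σ) x

/-- The action on `Ẽ`. -/
noncomputable def actEt : scalingEnd p →* (Et p →+* Et p) where
  toFun := actEtHom p
  map_one' := IsLocalization.ringHom_ext (nonZeroDivisors (Etp p)) (RingHom.ext fun x =>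
    actEtHom_algebraMap p 1 x)
  map_mul' σ τ := IsLocalization.ringHom_ext (nonZeroDivisors (Etp p)) (RingHom.ext fun x => by
    refine (actEtHom_algebraMap p (σ * τ) x).trans (Eq.symm ?_)
    change actEtHom p σ (actEtHom p τ (algebraMap _ _ x)) = _
    rw [actEtHom_algebraMap, actEtHom_algebraMap]
    rfl)

theorem actEt_algebraMap (σ : scalingEnd p) (x : Etp p) :
    actEt p σ (algebraMap _ _ x) = algebraMap _ _ (σ.1 x) :=
  actEtHom_algebraMap p σ x

theorem absEt_actEt (σ : scalingEnd p) :
    ∃ c : ℝ, 0 < c ∧ ∀ x, absEt p (actEt p σ x) = absEt p x ^ c := by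
  obtain ⟨-, c, hc, h⟩ := σ.2
  refine ⟨c, hc, fun x => ?_⟩
  obtain ⟨a, b, hb, rfl⟩ := IsFractionRing.div_surjective (A := Etp p) x
  rw [map_div₀, map_div₀, map_div₀, actEt_algebraMap, actEt_algebraMap, absEt_algebraMap,
    absEt_algebraMap, absEt_algebraMap, absEt_algebraMap, h, h, NNReal.div_rpow]

/-- `Ã⁺ = W(Ẽ⁺)`. -/
abbrev Atp : Type := WittVector p (Etp p)

/-- `Ã = W(Ẽ)`. -/
abbrev At : Type := WittVector p (Et p)

/-- The inclusion `Ã⁺ → Ã`. -/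
noncomputable def AtpToAt : Atp p →+* At p := WittVector.map (algebraMap (Etp p) (Et p))

/-- The action on `Ã⁺`. -/
noncomputable def actAtp (σ : scalingEnd p) : Atp p →+* Atp p := WittVector.map σ.1

/-- The action on `Ã`. -/
noncomputable def actAt : scalingEnd p →* (At p →+* At p) where
  toFun σ := WittVector.map (actEt p σ)
  map_one' := by
    rw [map_one]
    exact RingHom.ext fun x => WittVector.ext fun n => WittVector.map_coeff _ _ _
  map_mul' σ τ := by
    rw [map_mul]
    refine RingHom.ext fun x => WittVector.ext fun n => ?_
    change _ = (WittVector.map (actEt p σ) (WittVector.map (actEt p τ) x)).coeff n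
    rw [WittVector.map_coeff, WittVector.map_coeff, WittVector.map_coeff]
    rfl

theorem actAt_AtpToAt (σ : scalingEnd p) (x : Atp p) :
    actAt p σ (AtpToAt p x) = AtpToAt p (actAtp p σ x) := by
  refine WittVector.ext fun n => ?_
  change (WittVector.map _ (WittVector.map _ x)).coeff n =
    (WittVector.map _ (WittVector.map _ x)).coeff n
  rw [WittVector.map_coeff, WittVector.map_coeff, WittVector.map_coeff, WittVector.map_coeff]
  exact actEt_algebraMap p σ _

/-- `B̃ = Ã[1/p]`, which is the fraction field of `Ã`. -/
def Bt : Type := FractionRing (At p)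

noncomputable instance : Field (Bt p) := inferInstanceAs (Field (FractionRing (At p)))
noncomputable instance : Algebra (At p) (Bt p) :=
  inferInstanceAs (Algebra (At p) (FractionRing (At p)))
instance : IsFractionRing (At p) (Bt p) :=
  inferInstanceAs (IsFractionRing (At p) (FractionRing (At p)))

theorem natCast_At_ne_zero : (p : At p) ≠ 0 := (WittVector.irreducible p).ne_zero

theorem natCast_Bt_ne_zero : (p : Bt p) ≠ 0 := by
  rw [← map_natCast (algebraMap (At p) (Bt p))]
  exact fun h => natCast_At_ne_zero p
    (IsFractionRing.injective (At p) (Bt p) (h.trans (map_zero _).symm))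

theorem exists_pow_mul_eq (x : Bt p) : ∃ (N : ℕ) (w : At p), (p : Bt p) ^ N * x = algebraMap _ _ w := by
  obtain ⟨a, b, hb, rfl⟩ := IsFractionRing.div_surjective (A := At p) x
  obtain ⟨N, u, hu⟩ := WittVector.exists_eq_pow_p_mul' b (nonZeroDivisors.ne_zero hb)
  refine ⟨N, a * (u⁻¹ : (At p)ˣ), ?_⟩
  have hu0 : algebraMap (At p) (Bt p) u ≠ 0 := (u.isUnit.map (algebraMap (At p) (Bt p))).ne_zero
  have hi : algebraMap (At p) (Bt p) (u⁻¹ : (At p)ˣ) = (algebraMap (At p) (Bt p) u)⁻¹ := by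
    refine eq_inv_of_mul_eq_one_left ?_
    rw [← map_mul, Units.inv_mul, map_one]
  have hp0 := natCast_Bt_ne_zero p
  rw [hu, map_mul, map_mul, map_pow, map_natCast, hi]
  field_simp

/-- `ℤ_p = W(𝔽_p) → Ã`. -/
noncomputable def zpToAt : ℤ_[p] →+* At p :=
  (WittVector.map (ZMod.castHom dvd_rfl (Et p))).comp (WittVector.equiv p).symm.toRingHom

theorem zpToAt_injective : Function.Injective (zpToAt p) :=
  (WittVector.map_injective _ (ZMod.castHom dvd_rfl (Et p)).injective).comp
    (WittVector.equiv p).symm.injective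

theorem zpToBt_injective :
    Function.Injective ((algebraMap (At p) (Bt p)).comp (zpToAt p)) :=
  (IsFractionRing.injective (At p) (Bt p)).comp (zpToAt_injective p)

/-- `ℚ_p = W(𝔽_p)[1/p] → B̃`. -/
noncomputable instance : Algebra ℚ_[p] (Bt p) :=
  (IsFractionRing.lift (A := ℤ_[p]) (K := ℚ_[p]) (zpToBt_injective p)).toAlgebra

theorem algebraMap_zp (z : ℤ_[p]) :
    algebraMap ℚ_[p] (Bt p) z = algebraMap (At p) (Bt p) (zpToAt p z) :=
  IsFractionRing.lift_algebraMap (zpToBt_injective p) z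

theorem exists_zp (c : ℚ_[p]) : ∃ (N : ℕ) (z : ℤ_[p]), (p : ℚ_[p]) ^ N * c = z := by
  obtain ⟨a, b, hb, rfl⟩ := IsFractionRing.div_surjective (A := ℤ_[p]) c
  have hb0 := nonZeroDivisors.ne_zero hb
  refine ⟨b.valuation, a * ((PadicInt.unitCoeff hb0)⁻¹ : ℤ_[p]ˣ), ?_⟩
  have h : (b : ℚ_[p]) = (PadicInt.unitCoeff hb0 : ℤ_[p]) * (p : ℚ_[p]) ^ b.valuation := by
    conv_lhs => rw [PadicInt.unitCoeff_spec hb0]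
    push_cast
    rfl
  have hu : ((PadicInt.unitCoeff hb0 : ℤ_[p]) : ℚ_[p]) *
      (((PadicInt.unitCoeff hb0)⁻¹ : ℤ_[p]ˣ) : ℤ_[p]) = 1 := by
    rw [← PadicInt.coe_mul, Units.mul_inv, PadicInt.coe_one]
  have hb1 : (b : ℚ_[p]) ≠ 0 := fun h => hb0 (Subtype.ext h)
  change (p : ℚ_[p]) ^ b.valuation * ((a : ℚ_[p]) / (b : ℚ_[p])) = _
  rw [PadicInt.coe_mul, mul_div_assoc', div_eq_iff hb1]
  conv_rhs => rw [h]
  linear_combination (-(a : ℚ_[p]) * (p : ℚ_[p]) ^ b.valuation) * hu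

theorem actAt_zpToAt (σ : scalingEnd p) (z : ℤ_[p]) : actAt p σ (zpToAt p z) = zpToAt p z := by
  refine WittVector.ext fun n => ?_
  change (WittVector.map _ (WittVector.map _ _)).coeff n = (WittVector.map _ _).coeff n
  rw [WittVector.map_coeff, WittVector.map_coeff]
  exact RingHom.congr_fun (RingHom.ext_zmod ((actEt p σ).comp (ZMod.castHom dvd_rfl (Et p)))
    (ZMod.castHom dvd_rfl (Et p))) _

theorem actAt_injective (σ : scalingEnd p) : Function.Injective (actAt p σ) :=
  WittVector.map_injective _ (actEt p σ).injective

/-- The extension of the action on `Ã` to the fraction field. -/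
noncomputable def actBtHom (σ : scalingEnd p) : Bt p →+* Bt p :=
  IsFractionRing.map (actAt_injective p σ)

theorem actBtHom_algebraMap (σ : scalingEnd p) (x : At p) :
    actBtHom p σ (algebraMap _ _ x) = algebraMap _ _ (actAt p σ x) :=
  fracMap_algebraMap (actAt_injective p σ) x

theorem actBtHom_commutes (σ : scalingEnd p) (c : ℚ_[p]) :
    actBtHom p σ (algebraMap ℚ_[p] (Bt p) c) = algebraMap ℚ_[p] (Bt p) c := by
  refine RingHom.congr_fun (f := (actBtHom p σ).comp (algebraMap ℚ_[p] (Bt p))) ?_ c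
  refine IsLocalization.ringHom_ext (nonZeroDivisors ℤ_[p]) (RingHom.ext fun z => ?_)
  refine (congrArg (actBtHom p σ) (algebraMap_zp p z)).trans ?_
  rw [actBtHom_algebraMap, actAt_zpToAt]
  exact (algebraMap_zp p z).symm

/-- The action on `B̃`. -/
noncomputable def actBt : scalingEnd p →* (Bt p →ₐ[ℚ_[p]] Bt p) where
  toFun σ := { actBtHom p σ with commutes' := actBtHom_commutes p σ }
  map_one' := AlgHom.coe_ringHom_injective
    (IsLocalization.ringHom_ext (nonZeroDivisors (At p)) (RingHom.ext fun x => by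
      refine (actBtHom_algebraMap p 1 x).trans ?_
      rw [map_one]; rfl))
  map_mul' σ τ := AlgHom.coe_ringHom_injective
    (IsLocalization.ringHom_ext (nonZeroDivisors (At p)) (RingHom.ext fun x => by
      refine (actBtHom_algebraMap p (σ * τ) x).trans (Eq.symm ?_)
      change actBtHom p σ (actBtHom p τ (algebraMap _ _ x)) = _
      rw [actBtHom_algebraMap, actBtHom_algebraMap, map_mul]
      rfl))

theorem actBt_algebraMap (σ : scalingEnd p) (x : At p) :
    actBt p σ (algebraMap _ _ x) = algebraMap _ _ (actAt p σ x) :=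
  actBtHom_algebraMap p σ x

/-! ### Fontaine's rings `𝔸 ⊆ Ã` and `𝔹 ⊆ B̃` -/

section Closure

variable {A B : Type} [CommRing A] [CommRing B]

/-- The closure of a subring in the `I`-adic topology. -/
def adicClosure (I : Ideal A) (S : Subring A) : Subring A where
  carrier := {x | ∀ n : ℕ, ∃ y ∈ S, x - y ∈ I ^ n}
  zero_mem' n := ⟨0, S.zero_mem, by rw [sub_zero]; exact Ideal.zero_mem _⟩
  one_mem' n := ⟨1, S.one_mem, by rw [sub_self]; exact Ideal.zero_mem _⟩
  add_mem' := by
    intro x x' hx hx' n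
    obtain ⟨y, hy, h⟩ := hx n
    obtain ⟨y', hy', h'⟩ := hx' n
    refine ⟨y + y', S.add_mem hy hy', ?_⟩
    rw [add_sub_add_comm]
    exact Ideal.add_mem _ h h'
  neg_mem' := by
    intro x hx n
    obtain ⟨y, hy, h⟩ := hx n
    refine ⟨-y, S.neg_mem hy, ?_⟩
    rw [neg_sub_neg, ← neg_sub]
    exact Ideal.neg_mem_iff _ |>.mpr h
  mul_mem' := by
    intro x x' hx hx' n
    obtain ⟨y, hy, h⟩ := hx n
    obtain ⟨y', hy', h'⟩ := hx' n
    refine ⟨y * y', S.mul_mem hy hy', ?_⟩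
    rw [show x * x' - y * y' = x * (x' - y') + y' * (x - y) by ring]
    exact Ideal.add_mem _ (Ideal.mul_mem_left _ _ h') (Ideal.mul_mem_left _ _ h)

theorem subset_adicClosure {I : Ideal A} {S : Subring A} {x : A} (hx : x ∈ S) :
    x ∈ adicClosure I S :=
  fun _ => ⟨x, hx, by rw [sub_self]; exact Ideal.zero_mem _⟩

theorem adicClosure_map (f : A →+* B) {I : Ideal A} {J : Ideal B} {S : Subring A} {T : Subring B}
    (hI : I ≤ J.comap f) (hS : S ≤ T.comap f) :
    adicClosure I S ≤ (adicClosure J T).comap f := by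
  intro x hx n
  obtain ⟨y, hy, h⟩ := hx n
  refine ⟨f y, hS hy, ?_⟩
  rw [← map_sub]
  have : (J ^ n).comap f ≥ I ^ n := by
    rw [ge_iff_le, ← Ideal.map_le_iff_le_comap, Ideal.map_pow]
    exact Ideal.pow_right_mono (Ideal.map_le_iff_le_comap.mpr hI) n
  exact this h

theorem span_p_le_comap (q : ℕ) (f : A →+* B) :
    Ideal.span {(q : A)} ≤ (Ideal.span {(q : B)}).comap f := by
  rw [Ideal.span_le, Set.singleton_subset_iff]
  change f (q : A) ∈ Ideal.span {(q : B)}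
  rw [map_natCast]
  exact Ideal.mem_span_singleton_self _

end Closure

/-- The ideal `(p, [η] - 1 : η ∈ ℤ_p(1))` of `Ã⁺`; it defines the weak topology on `Ã⁺`. -/
noncomputable def weakIdeal : Ideal (Atp p) :=
  Ideal.span ({(p : Atp p)} ∪ {x | ∃ η ∈ tateModule p, x = WittVector.teichmuller p η - 1})

/-- `𝔸⁺_{ℚ_p} = ℤ_p[[π]] ⊆ Ã⁺`, `π = [ε] - 1`, as the closure of the ring generated by the
elements `[η]`, `η ∈ ℤ_p(1)`. -/
noncomputable def AQpPlus : Subring (Atp p) :=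
  adicClosure (weakIdeal p) (Subring.closure (WittVector.teichmuller p '' tateModule p))

/-- `𝔸_{ℚ_p} ⊆ Ã`, the `p`-adic closure of `ℤ_p[[π]][1/π]`. -/
noncomputable def AQp : Subring (At p) :=
  adicClosure (Ideal.span {(p : At p)}) (Subring.closure (AtpToAt p '' AQpPlus p ∪
    {y | ∃ η ∈ tateModule p, AtpToAt p (WittVector.teichmuller p η - 1) * y = 1}))

/-- The maximal unramified extension of `𝔸_{ℚ_p}` in `Ã`: it is generated by the elements which
are simple roots modulo `p` of monic polynomials over `𝔸_{ℚ_p}`. -/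
noncomputable def Aur : Subring (At p) :=
  Subring.closure {x | ∃ f : Polynomial (At p), f.Monic ∧ (∀ i, f.coeff i ∈ AQp p) ∧
    f.eval x = 0 ∧ IsUnit (f.derivative.eval x)}

/-- `𝔸`, the `p`-adic completion of the maximal unramified extension of `𝔸_{ℚ_p}` in `Ã`. -/
noncomputable def FontaineA : Subring (At p) := adicClosure (Ideal.span {(p : At p)}) (Aur p)

theorem actAtp_teichmuller (σ : scalingEnd p) (η : Etp p) :
    actAtp p σ (WittVector.teichmuller p η) = WittVector.teichmuller p (σ.1 η) :=
  WittVector.map_teichmuller _ _ _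

theorem actAtp_AQpPlus (σ : scalingEnd p) : AQpPlus p ≤ (AQpPlus p).comap (actAtp p σ) := by
  refine adicClosure_map _ ?_ ?_
  · rw [weakIdeal, Ideal.span_le]
    rintro x (rfl | ⟨η, hη, rfl⟩)
    · change actAtp p σ (p : Atp p) ∈ weakIdeal p
      rw [map_natCast]
      exact Ideal.subset_span (Or.inl rfl)
    · refine Ideal.subset_span (Or.inr ⟨σ.1 η, σ.2.1 η hη, ?_⟩)
      rw [map_sub, actAtp_teichmuller, map_one]
  · rw [Subring.closure_le]
    rintro _ ⟨η, hη, rfl⟩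
    exact Subring.subset_closure ⟨σ.1 η, σ.2.1 η hη, (actAtp_teichmuller p σ η).symm⟩

theorem actAt_AQp (σ : scalingEnd p) : AQp p ≤ (AQp p).comap (actAt p σ) := by
  refine adicClosure_map _ (span_p_le_comap p _) ?_
  rw [Subring.closure_le]
  rintro _ (⟨x, hx, rfl⟩ | ⟨η, hη, h⟩)
  · exact Subring.subset_closure (Or.inl ⟨_, actAtp_AQpPlus p σ hx, (actAt_AtpToAt p σ x).symm⟩)
  · refine Subring.subset_closure (Or.inr ⟨σ.1 η, σ.2.1 η hη, ?_⟩)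
    have := congrArg (actAt p σ) h
    rw [map_mul, map_one, actAt_AtpToAt, map_sub, map_one, actAtp_teichmuller] at this
    exact this

theorem actAt_Aur (σ : scalingEnd p) : Aur p ≤ (Aur p).comap (actAt p σ) := by
  rw [Aur, Subring.closure_le]
  rintro x ⟨f, hf, hc, h0, hu⟩
  refine Subring.subset_closure ⟨f.map (actAt p σ), hf.map _, fun i => ?_, ?_, ?_⟩
  · rw [Polynomial.coeff_map]
    exact actAt_AQp p σ (hc i)
  · rw [Polynomial.eval_map, Polynomial.eval₂_at_apply, h0, map_zero]
  · rw [Polynomial.derivative_map, Polynomial.eval_map, Polynomial.eval₂_at_apply]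
    exact hu.map _

theorem actAt_FontaineA (σ : scalingEnd p) : FontaineA p ≤ (FontaineA p).comap (actAt p σ) :=
  adicClosure_map _ (span_p_le_comap p _) (actAt_Aur p σ)

theorem zpToAt_approx (z : ℤ_[p]) (n : ℕ) : ∃ (k : ℕ) (w : At p), zpToAt p z - k = p ^ n * w := by
  have := PadicInt.appr_spec n z
  rw [Ideal.mem_span_singleton] at this
  obtain ⟨w, hw⟩ := this
  refine ⟨z.appr n, zpToAt p w, ?_⟩
  have := congrArg (zpToAt p) hw
  rw [map_sub, map_mul, map_pow, map_natCast, map_natCast] at this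
  exact this

theorem zpToAt_mem (z : ℤ_[p]) : zpToAt p z ∈ FontaineA p := by
  intro n
  obtain ⟨k, w, h⟩ := zpToAt_approx p z n
  refine ⟨k, natCast_mem _ k, ?_⟩
  rw [h, Ideal.span_singleton_pow]
  exact Ideal.mul_mem_right _ _ (Ideal.mem_span_singleton_self _)

/-- `𝔹 = 𝔸[1/p]`. -/
noncomputable def FontaineB : Subalgebra ℚ_[p] (Bt p) where
  carrier := {x | ∃ (N : ℕ), ∃ a ∈ FontaineA p, (p : Bt p) ^ N * x = algebraMap (At p) (Bt p) a}
  algebraMap_mem' c := by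
    obtain ⟨N, z, h⟩ := exists_zp p c
    refine ⟨N, zpToAt p z, zpToAt_mem p z, ?_⟩
    rw [← algebraMap_zp, ← h, map_mul, map_pow, map_natCast]
  add_mem' := by
    rintro x y ⟨N, a, ha, hx⟩ ⟨M, b, hb, hy⟩
    refine ⟨N + M, p ^ M * a + p ^ N * b, add_mem (mul_mem (pow_mem (natCast_mem _ p) _) ha)
      (mul_mem (pow_mem (natCast_mem _ p) _) hb), ?_⟩
    simp only [map_add, map_mul, map_pow, map_natCast, ← hx, ← hy]
    ring
  mul_mem' := by
    rintro x y ⟨N, a, ha, hx⟩ ⟨M, b, hb, hy⟩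
    refine ⟨N + M, a * b, mul_mem ha hb, ?_⟩
    rw [map_mul, ← hx, ← hy]
    ring

theorem actBt_FontaineB (σ : scalingEnd p) {x : Bt p} (hx : x ∈ FontaineB p) :
    actBt p σ x ∈ FontaineB p := by
  obtain ⟨N, a, ha, h⟩ := hx
  refine ⟨N, actAt p σ a, actAt_FontaineA p σ ha, ?_⟩
  rw [← actBt_algebraMap, ← h, map_mul, map_pow, map_natCast]

/-! ### Overconvergence and the ring `B̃^†_rig` -/

/-- The elements `p ^ k [a]`, `k ∈ ℤ`, `a ∈ Ẽ`, with `v_E(a) + k p s / (p - 1) ≥ 0`. -/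
noncomputable def radiusGens (s : ℝ) : Set (Bt p) :=
  {x | ∃ (k : ℤ) (a : Et p), absEt p a ≤ (p : ℝ≥0) ^ (k * (p * s / (p - 1)) : ℝ) ∧
    x = (p : Bt p) ^ k * algebraMap (At p) (Bt p) (WittVector.teichmuller p a)}

/-- The ring of all `x = ∑ p ^ k [x_k] ∈ B̃` with `v_E(x_k) + k p s / (p - 1) ≥ 0` for all `k`,
as the `p`-adic closure of the ring generated by the single terms. -/
noncomputable def Lam (s : ℝ) : Subring (Bt p) where
  carrier := {x | ∀ n : ℕ, ∃ y ∈ Subring.closure (radiusGens p s), ∃ w : At p,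
    x - y = (p : Bt p) ^ n * algebraMap (At p) (Bt p) w}
  zero_mem' n := ⟨0, zero_mem _, 0, by simp⟩
  one_mem' n := ⟨1, one_mem _, 0, by simp⟩
  add_mem' := by
    intro x x' hx hx' n
    obtain ⟨y, hy, w, h⟩ := hx n
    obtain ⟨y', hy', w', h'⟩ := hx' n
    refine ⟨y + y', add_mem hy hy', w + w', ?_⟩
    rw [add_sub_add_comm, h, h', map_add]
    ring
  neg_mem' := by
    intro x hx n
    obtain ⟨y, hy, w, h⟩ := hx n
    refine ⟨-y, neg_mem hy, -w, ?_⟩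
    rw [neg_sub_neg, ← neg_sub, h, map_neg]
    ring
  mul_mem' := by
    intro x x' hx hx' n
    obtain ⟨N', v', hv'⟩ := exists_pow_mul_eq p x'
    obtain ⟨y, hy, w, h⟩ := hx (n + N')
    obtain ⟨N, v, hv⟩ := exists_pow_mul_eq p y
    obtain ⟨y', hy', w', h'⟩ := hx' (n + N)
    refine ⟨y * y', mul_mem hy hy', w * v' + v * w', ?_⟩
    rw [show x * x' - y * y' = (x - y) * x' + y * (x' - y') by ring, h, h', map_add, map_mul,
      map_mul, ← hv, ← hv']
    ring

theorem actBt_teichmuller (σ : scalingEnd p) (a : Et p) :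
    actBt p σ (algebraMap (At p) (Bt p) (WittVector.teichmuller p a)) =
      algebraMap (At p) (Bt p) (WittVector.teichmuller p (actEt p σ a)) := by
  rw [actBt_algebraMap]
  exact congrArg _ (WittVector.map_teichmuller _ _ _)

theorem actBt_radiusGens {σ : scalingEnd p} {c : ℝ} (hc : 0 < c)
    (hσ : ∀ x, absEt p (actEt p σ x) = absEt p x ^ c) {s : ℝ} {x : Bt p}
    (hx : x ∈ radiusGens p s) : actBt p σ x ∈ radiusGens p (c * s) := by
  obtain ⟨k, a, ha, rfl⟩ := hx
  refine ⟨k, actEt p σ a, ?_, ?_⟩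
  · rw [hσ]
    refine (NNReal.rpow_le_rpow ha hc.le).trans (le_of_eq ?_)
    rw [← NNReal.rpow_mul]
    congr 1
    ring
  · rw [map_mul, map_zpow₀, map_natCast, actBt_teichmuller]

theorem actBt_closure {σ : scalingEnd p} {c : ℝ} (hc : 0 < c)
    (hσ : ∀ x, absEt p (actEt p σ x) = absEt p x ^ c) {s : ℝ} {x : Bt p}
    (hx : x ∈ Subring.closure (radiusGens p s)) :
    actBt p σ x ∈ Subring.closure (radiusGens p (c * s)) := by
  induction hx using Subring.closure_induction with
  | mem x hx => exact Subring.subset_closure (actBt_radiusGens p hc hσ hx)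
  | zero => rw [map_zero]; exact zero_mem _
  | one => rw [map_one]; exact one_mem _
  | add x y _ _ hx hy => rw [map_add]; exact add_mem hx hy
  | neg x _ hx => rw [map_neg]; exact neg_mem hx
  | mul x y _ _ hx hy => rw [map_mul]; exact mul_mem hx hy

theorem actBt_Lam (σ : scalingEnd p) :
    ∃ c : ℝ, 0 < c ∧ ∀ s, ∀ x ∈ Lam p s, actBt p σ x ∈ Lam p (c * s) := by
  obtain ⟨c, hc, hσ⟩ := absEt_actEt p σ
  refine ⟨c, hc, fun s x hx n => ?_⟩
  obtain ⟨y, hy, w, h⟩ := hx n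
  refine ⟨actBt p σ y, actBt_closure p hc hσ hy, actAt p σ w, ?_⟩
  rw [← map_sub, h, map_mul, map_pow, map_natCast, actBt_algebraMap]

theorem algebraMap_zp_mem_Lam (s : ℝ) (z : ℤ_[p]) : algebraMap ℚ_[p] (Bt p) z ∈ Lam p s := by
  intro n
  obtain ⟨k, w, h⟩ := zpToAt_approx p z n
  refine ⟨k, natCast_mem _ k, w, ?_⟩
  rw [algebraMap_zp, ← map_natCast (algebraMap (At p) (Bt p)), ← map_sub, h, map_mul, map_pow,
    map_natCast]

theorem p_mul_Lam {s : ℝ} {x : Bt p} (hx : x ∈ Lam p s) (N : ℕ) : (p : Bt p) ^ N * x ∈ Lam p s :=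
  mul_mem (pow_mem (natCast_mem _ p) N) hx

/-- The elements of `B̃` which are bounded at radius `s`: `v_E(x_k) + k p s / (p - 1)` is bounded
below. -/
noncomputable def boundedAt (s : ℝ) : Subalgebra ℚ_[p] (Bt p) where
  carrier := {x | ∃ N : ℕ, (p : Bt p) ^ N * x ∈ Lam p s}
  algebraMap_mem' c := by
    obtain ⟨N, z, h⟩ := exists_zp p c
    refine ⟨N, ?_⟩
    have := algebraMap_zp_mem_Lam p s z
    rwa [← h, map_mul, map_pow, map_natCast] at this
  add_mem' := by
    rintro x y ⟨N, hx⟩ ⟨M, hy⟩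
    refine ⟨N + M, ?_⟩
    have := add_mem (p_mul_Lam p hx M) (p_mul_Lam p hy N)
    convert this using 1
    ring
  mul_mem' := by
    rintro x y ⟨N, hx⟩ ⟨M, hy⟩
    refine ⟨N + M, ?_⟩
    convert mul_mem hx hy using 1
    ring

/-- `B̃^†`, the overconvergent elements of `B̃`. -/
noncomputable def Overconvergent : Subalgebra ℚ_[p] (Bt p) where
  carrier := {x | ∃ r : ℝ, 0 < r ∧ ∀ s, r ≤ s → x ∈ boundedAt p s}
  algebraMap_mem' c := ⟨1, one_pos, fun _ _ => algebraMap_mem _ c⟩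
  add_mem' := by
    rintro x y ⟨r, hr, hx⟩ ⟨r', hr', hy⟩
    exact ⟨max r r', lt_max_of_lt_left hr, fun s hs =>
      add_mem (hx s ((le_max_left _ _).trans hs)) (hy s ((le_max_right _ _).trans hs))⟩
  mul_mem' := by
    rintro x y ⟨r, hr, hx⟩ ⟨r', hr', hy⟩
    exact ⟨max r r', lt_max_of_lt_left hr, fun s hs =>
      mul_mem (hx s ((le_max_left _ _).trans hs)) (hy s ((le_max_right _ _).trans hs))⟩

theorem actBt_boundedAt {σ : scalingEnd p} {c : ℝ}
    (hσ : ∀ s, ∀ x ∈ Lam p s, actBt p σ x ∈ Lam p (c * s)) {s : ℝ} {x : Bt p}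
    (hx : x ∈ boundedAt p s) : actBt p σ x ∈ boundedAt p (c * s) := by
  obtain ⟨N, h⟩ := hx
  refine ⟨N, ?_⟩
  have := hσ s _ h
  rwa [map_mul, map_pow, map_natCast] at this

theorem actBt_Overconvergent (σ : scalingEnd p) {x : Bt p} (hx : x ∈ Overconvergent p) :
    actBt p σ x ∈ Overconvergent p := by
  obtain ⟨c, hc, hσ⟩ := actBt_Lam p σ
  obtain ⟨r, hr, h⟩ := hx
  refine ⟨c * r, mul_pos hc hr, fun s hs => ?_⟩
  have := actBt_boundedAt p hσ (h (s / c) ((le_div_iff₀ hc).mpr (by rwa [mul_comm])))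
  rwa [mul_div_cancel₀ _ hc.ne'] at this

/-- The sequence tends to `0` at radius `s`. -/
def NullAt (s : ℝ) (x : ℕ → Bt p) : Prop :=
  ∀ N : ℕ, ∃ n₀ : ℕ, ∀ n, n₀ ≤ n → ∃ y ∈ Lam p s, x n = (p : Bt p) ^ N * y

/-- The sequences which are Cauchy for the norm at radius `s`. -/
noncomputable def cauchyAt (s : ℝ) : Subalgebra ℚ_[p] (ℕ → Bt p) where
  carrier := {x | (∀ n, x n ∈ boundedAt p s) ∧ ∀ N : ℕ, ∃ n₀ : ℕ, ∀ m n, n₀ ≤ m → n₀ ≤ n →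
    ∃ y ∈ Lam p s, x m - x n = (p : Bt p) ^ N * y}
  algebraMap_mem' c := ⟨fun _ => algebraMap_mem (boundedAt p s) c,
    fun _ => ⟨0, fun _ _ _ _ => ⟨0, zero_mem _, by
      rw [Pi.algebraMap_apply, Pi.algebraMap_apply, sub_self, mul_zero]⟩⟩⟩
  add_mem' := by
    rintro x x' ⟨hx, h⟩ ⟨hx', h'⟩
    refine ⟨fun n => add_mem (hx n) (hx' n), fun N => ?_⟩
    obtain ⟨n₀, h⟩ := h N
    obtain ⟨n₁, h'⟩ := h' N
    refine ⟨max n₀ n₁, fun m n hm hn => ?_⟩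
    obtain ⟨y, hy, e⟩ := h m n ((le_max_left _ _).trans hm) ((le_max_left _ _).trans hn)
    obtain ⟨y', hy', e'⟩ := h' m n ((le_max_right _ _).trans hm) ((le_max_right _ _).trans hn)
    refine ⟨y + y', add_mem hy hy', ?_⟩
    rw [Pi.add_apply, Pi.add_apply, add_sub_add_comm, e, e', mul_add]
  mul_mem' := by
    rintro x x' ⟨hx, h⟩ ⟨hx', h'⟩
    refine ⟨fun n => mul_mem (hx n) (hx' n), fun N => ?_⟩
    obtain ⟨n₀, h0⟩ := h 0
    obtain ⟨n₁, h1⟩ := h' 0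
    obtain ⟨M, hM⟩ := hx n₀
    obtain ⟨M', hM'⟩ := hx' n₁
    obtain ⟨n₂, h2⟩ := h (N + M')
    obtain ⟨n₃, h3⟩ := h' (N + M)
    refine ⟨max (max n₀ n₁) (max n₂ n₃), fun m n hm hn => ?_⟩
    simp only [max_le_iff] at hm hn
    obtain ⟨a, ha, ea⟩ := h0 m n₀ hm.1.1 le_rfl
    obtain ⟨b, hb, eb⟩ := h1 n n₁ hn.1.2 le_rfl
    obtain ⟨y, hy, e⟩ := h2 m n hm.2.1 hn.2.1
    obtain ⟨y', hy', e'⟩ := h3 m n hm.2.2 hn.2.2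
    rw [pow_zero, one_mul] at ea eb
    have h4 : (p : Bt p) ^ M * x m ∈ Lam p s := by
      rw [show x m = a + x n₀ by rw [← ea]; ring, mul_add]
      exact add_mem (p_mul_Lam p ha M) hM
    have h5 : (p : Bt p) ^ M' * x' n ∈ Lam p s := by
      rw [show x' n = b + x' n₁ by rw [← eb]; ring, mul_add]
      exact add_mem (p_mul_Lam p hb M') hM'
    refine ⟨p ^ M * x m * y' + p ^ M' * x' n * y, add_mem (mul_mem h4 hy') (mul_mem h5 hy), ?_⟩
    rw [Pi.mul_apply, Pi.mul_apply,
      show x m * x' m - x n * x' n = x m * (x' m - x' n) + (x m - x n) * x' n by ring, e, e']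
    ring

theorem NullAt.add {s : ℝ} {x x' : ℕ → Bt p} (h : NullAt p s x) (h' : NullAt p s x') :
    NullAt p s (x + x') := by
  intro N
  obtain ⟨n₀, h⟩ := h N
  obtain ⟨n₁, h'⟩ := h' N
  refine ⟨max n₀ n₁, fun n hn => ?_⟩
  obtain ⟨y, hy, e⟩ := h n ((le_max_left _ _).trans hn)
  obtain ⟨y', hy', e'⟩ := h' n ((le_max_right _ _).trans hn)
  exact ⟨y + y', add_mem hy hy', by rw [Pi.add_apply, e, e', mul_add]⟩

theorem NullAt.mul {s : ℝ} {x x' : ℕ → Bt p} (hx : x ∈ cauchyAt p s) (h' : NullAt p s x') :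
    NullAt p s (x * x') := by
  obtain ⟨hb, hc⟩ := hx
  intro N
  obtain ⟨n₀, h0⟩ := hc 0
  obtain ⟨M, hM⟩ := hb n₀
  obtain ⟨n₁, h'⟩ := h' (N + M)
  refine ⟨max n₀ n₁, fun n hn => ?_⟩
  obtain ⟨a, ha, ea⟩ := h0 n n₀ ((le_max_left _ _).trans hn) le_rfl
  obtain ⟨y', hy', e'⟩ := h' n ((le_max_right _ _).trans hn)
  rw [pow_zero, one_mul] at ea
  have h4 : (p : Bt p) ^ M * x n ∈ Lam p s := by
    rw [show x n = a + x n₀ by rw [← ea]; ring, mul_add]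
    exact add_mem (p_mul_Lam p ha M) hM
  exact ⟨_, mul_mem h4 hy', by rw [Pi.mul_apply, e']; ring⟩

/-- The sequences which are Cauchy for the norms at all radii `s ≥ r`, for some `r > 0`. -/
noncomputable def cauchyRig : Subalgebra ℚ_[p] (ℕ → Bt p) where
  carrier := {x | ∃ r : ℝ, 0 < r ∧ ∀ s, r ≤ s → x ∈ cauchyAt p s}
  algebraMap_mem' c := ⟨1, one_pos, fun _ _ => algebraMap_mem _ c⟩
  add_mem' := by
    rintro x y ⟨r, hr, hx⟩ ⟨r', hr', hy⟩
    exact ⟨max r r', lt_max_of_lt_left hr, fun s hs =>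
      add_mem (hx s ((le_max_left _ _).trans hs)) (hy s ((le_max_right _ _).trans hs))⟩
  mul_mem' := by
    rintro x y ⟨r, hr, hx⟩ ⟨r', hr', hy⟩
    exact ⟨max r r', lt_max_of_lt_left hr, fun s hs =>
      mul_mem (hx s ((le_max_left _ _).trans hs)) (hy s ((le_max_right _ _).trans hs))⟩

/-- The ideal of sequences tending to `0` at all radii `s ≥ r`, for some `r > 0`. -/
noncomputable def nullRig : Ideal (cauchyRig p) where
  carrier := {x | ∃ r : ℝ, 0 < r ∧ ∀ s, r ≤ s → NullAt p s x.1}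
  zero_mem' := ⟨1, one_pos, fun _ _ _ => ⟨0, fun _ _ => ⟨0, zero_mem _, (mul_zero _).symm⟩⟩⟩
  add_mem' := by
    rintro x y ⟨r, hr, hx⟩ ⟨r', hr', hy⟩
    exact ⟨max r r', lt_max_of_lt_left hr, fun s hs =>
      (hx s ((le_max_left _ _).trans hs)).add p (hy s ((le_max_right _ _).trans hs))⟩
  smul_mem' := by
    rintro x y ⟨r', hr', hy⟩
    obtain ⟨r, hr, hx⟩ := x.2
    exact ⟨max r r', lt_max_of_lt_left hr, fun s hs =>
      NullAt.mul p (hx s ((le_max_left _ _).trans hs)) (hy s ((le_max_right _ _).trans hs))⟩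

/-- `B̃^†_rig`: the union over `r` of the Fréchet completions of `B̃^{†,r}` for the norms at the
radii `s ≥ r`. -/
def Rig : Type := cauchyRig p ⧸ nullRig p

noncomputable instance : CommRing (Rig p) := inferInstanceAs (CommRing (cauchyRig p ⧸ nullRig p))
noncomputable instance : Algebra ℚ_[p] (Rig p) :=
  inferInstanceAs (Algebra ℚ_[p] (cauchyRig p ⧸ nullRig p))

/-- The limit of a Cauchy sequence. -/
noncomputable def toRig : cauchyRig p →ₐ[ℚ_[p]] Rig p := Ideal.Quotient.mkₐ ℚ_[p] (nullRig p)

/-- The termwise action on sequences. -/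
noncomputable def actSeq (σ : scalingEnd p) : cauchyRig p →ₐ[ℚ_[p]] cauchyRig p :=
  (((actBt p σ).compLeft ℕ).comp (cauchyRig p).val).codRestrict (cauchyRig p) (by
    rintro ⟨x, r, hr, hx⟩
    obtain ⟨c, hc, hσ⟩ := actBt_Lam p σ
    refine ⟨c * r, mul_pos hc hr, fun s hs => ?_⟩
    obtain ⟨h1, h2⟩ := hx (s / c) ((le_div_iff₀ hc).mpr (by rwa [mul_comm]))
    rw [← mul_div_cancel₀ s hc.ne']
    refine ⟨fun n => actBt_boundedAt p hσ (h1 n), fun N => ?_⟩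
    obtain ⟨n₀, h⟩ := h2 N
    refine ⟨n₀, fun m n hm hn => ?_⟩
    obtain ⟨y, hy, e⟩ := h m n hm hn
    refine ⟨_, hσ _ y hy, ?_⟩
    change actBt p σ (x m) - actBt p σ (x n) = _
    rw [← map_sub, e, map_mul, map_pow, map_natCast])

theorem actSeq_apply (σ : scalingEnd p) (x : cauchyRig p) (n : ℕ) :
    (actSeq p σ x).1 n = actBt p σ (x.1 n) := rfl

theorem actSeq_null (σ : scalingEnd p) : nullRig p ≤ (nullRig p).comap (actSeq p σ) := by
  rintro ⟨x, hx'⟩ ⟨r, hr, hx⟩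
  obtain ⟨c, hc, hσ⟩ := actBt_Lam p σ
  refine ⟨c * r, mul_pos hc hr, fun s hs N => ?_⟩
  obtain ⟨n₀, h⟩ := hx (s / c) ((le_div_iff₀ hc).mpr (by rwa [mul_comm])) N
  refine ⟨n₀, fun n hn => ?_⟩
  obtain ⟨y, hy, e⟩ := h n hn
  refine ⟨_, by rw [← mul_div_cancel₀ s hc.ne']; exact hσ _ y hy, ?_⟩
  change actBt p σ (x n) = _
  change x n = _ at e
  rw [e, map_mul, map_pow, map_natCast]

/-- The action on `B̃^†_rig`. -/
noncomputable def actRig : scalingEnd p →* (Rig p →ₐ[ℚ_[p]] Rig p) where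
  toFun σ := Ideal.quotientMapₐ (nullRig p) (actSeq p σ) (actSeq_null p σ)
  map_one' := by
    refine Ideal.Quotient.algHom_ext ℚ_[p] (AlgHom.ext fun x => ?_)
    refine congrArg (toRig p) (Subtype.ext (funext fun n => ?_))
    change actBt p 1 (x.1 n) = x.1 n
    rw [map_one]
    rfl
  map_mul' σ τ := by
    refine Ideal.Quotient.algHom_ext ℚ_[p] (AlgHom.ext fun x => ?_)
    refine congrArg (toRig p) (Subtype.ext (funext fun n => ?_))
    change actBt p (σ * τ) _ = actBt p σ (actBt p τ _)
    rw [map_mul]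
    rfl

theorem actRig_toRig (σ : scalingEnd p) (x : cauchyRig p) :
    actRig p σ (toRig p x) = toRig p (actSeq p σ x) := rfl

/-! ### The groups `Γ_K` -/

section Groups

variable (K L : IntermediateField ℚ_[p] (PadicAlgCl p))

/-- The `p`-adic cyclotomic character on `G_K`. -/
noncomputable def cycloChar : K.fixingSubgroup →* ℤ_[p]ˣ :=
  ((cyclotomicCharacter (PadicAlgCl p) p).comp
    (MulSemiringAction.toRingAut (AbsGal p) (PadicAlgCl p))).comp K.fixingSubgroup.subtype

/-- `H_K`, the kernel of the cyclotomic character on `G_K`. -/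
noncomputable abbrev HK : Subgroup K.fixingSubgroup := (cycloChar p K).ker

/-- `Γ_K = G_K / H_K`. -/
abbrev GammaK : Type := K.fixingSubgroup ⧸ HK p K

noncomputable instance : CommGroup (GammaK p K) :=
  { (inferInstance : Group (GammaK p K)) with
    mul_comm := fun a b => QuotientGroup.kerLift_injective (cycloChar p K) (by
      rw [map_mul, map_mul, mul_comm]) }

variable {K L}

/-- The inclusion `G_L → G_K`. -/
noncomputable def galIncl (h : K ≤ L) : L.fixingSubgroup →* K.fixingSubgroup :=
  Subgroup.inclusion (IntermediateField.fixingSubgroup_antitone h)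

theorem cycloChar_galIncl (h : K ≤ L) (g : L.fixingSubgroup) :
    cycloChar p K (galIncl p h g) = cycloChar p L g := rfl

/-- The injection `Γ_L → Γ_K`. -/
noncomputable def gammaIncl (h : K ≤ L) : GammaK p L →* GammaK p K :=
  QuotientGroup.map (HK p L) (HK p K) (galIncl p h) (fun _ hg => hg)

theorem gammaIncl_injective (h : K ≤ L) : Function.Injective (gammaIncl p h) := by
  refine (injective_iff_map_eq_one _).mpr fun x hx => ?_
  obtain ⟨g, rfl⟩ := QuotientGroup.mk_surjective x
  exact (QuotientGroup.eq_one_iff _).mpr ((QuotientGroup.eq_one_iff (galIncl p h g)).mp hx)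

end Groups

/-! ### Rings of `H_K`-invariants -/

section Invariants

variable {T : Type} [CommRing T] [Algebra ℚ_[p] T] (ρ : scalingEnd p →* (T →ₐ[ℚ_[p]] T))
  (K L : IntermediateField ℚ_[p] (PadicAlgCl p))

/-- The condition on a subring of `B̃` or `B̃^†_rig` to be stable under `φ` and `G_K` and fixed by
`H_K`. -/
structure IsStableSubalgebra (S : Subalgebra ℚ_[p] T) : Prop where
  frob_mem : ∀ x ∈ S, ρ (frobS p) x ∈ S
  gal_mem : ∀ g ∈ K.fixingSubgroup, ∀ x ∈ S, ρ (galS p g) x ∈ S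
  gal_eq : ∀ h ∈ HK p K, ∀ x ∈ S, ρ (galS p h) x = x

variable {K L}

/-- The action of `G_K` on a stable subring. -/
noncomputable def stableGal {S : Subalgebra ℚ_[p] T} (hS : IsStableSubalgebra p ρ K S) :
    K.fixingSubgroup →* (S →ₐ[ℚ_[p]] S) where
  toFun g := ((ρ (galS p g)).comp S.val).codRestrict S (fun x => hS.gal_mem g g.2 x x.2)
  map_one' := AlgHom.ext fun x => Subtype.ext (by
    change ρ (galS p (1 : AbsGal p)) x = x
    rw [map_one, map_one]; rfl)
  map_mul' g h := AlgHom.ext fun x => Subtype.ext (by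
    change ρ (galS p (g.1 * h.1)) x = ρ (galS p g) (ρ (galS p h) x)
    rw [map_mul, map_mul]; rfl)

/-- A stable subring with its actions of `φ` and `Γ_K`. -/
noncomputable def stableRing {S : Subalgebra ℚ_[p] T} (hS : IsStableSubalgebra p ρ K S) :
    PhiGammaRing p (GammaK p K) where
  carrier := S
  frob := ((ρ (frobS p)).comp S.val).codRestrict S (fun x => hS.frob_mem x x.2)
  act := QuotientGroup.lift (HK p K) (stableGal p ρ hS) (fun h hh =>
    AlgHom.ext fun x => Subtype.ext (hS.gal_eq h hh x x.2))
  act_frob := by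
    intro g a
    obtain ⟨g, rfl⟩ := QuotientGroup.mk_surjective g
    refine Subtype.ext ?_
    change ρ (galS p g) (ρ (frobS p) a) = ρ (frobS p) (ρ (galS p g) a)
    rw [← AlgHom.mul_apply, ← AlgHom.mul_apply, ← map_mul, ← map_mul, frobS_comm]

/-- The inclusion of a stable subring in another one. -/
noncomputable def stableIncl (h : K ≤ L) {S S' : Subalgebra ℚ_[p] T}
    (hS : IsStableSubalgebra p ρ K S) (hS' : IsStableSubalgebra p ρ L S') (hSS' : S ≤ S') :
    (stableRing p ρ hS).Hom (stableRing p ρ hS') (gammaIncl p h) where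
  toAlgHom := Subalgebra.inclusion hSS'
  map_frob := fun _ => rfl
  map_act := fun g _ => by
    obtain ⟨g, rfl⟩ := QuotientGroup.mk_surjective g
    rfl

end Invariants

section Coefficients

variable (K L : IntermediateField ℚ_[p] (PadicAlgCl p))

/-- `E_K = 𝔹_K = 𝔹^{H_K}`. -/
noncomputable def EK : Subalgebra ℚ_[p] (Bt p) where
  carrier := {x | x ∈ FontaineB p ∧ ∀ h ∈ HK p K, actBt p (galS p h) x = x}
  algebraMap_mem' c := ⟨algebraMap_mem _ c, fun _ _ => AlgHom.commutes _ c⟩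
  add_mem' := fun hx hy => ⟨add_mem hx.1 hy.1, fun h hh => by
    rw [map_add, hx.2 h hh, hy.2 h hh]⟩
  mul_mem' := fun hx hy => ⟨mul_mem hx.1 hy.1, fun h hh => by
    rw [map_mul, hx.2 h hh, hy.2 h hh]⟩

/-- `E†_K = 𝔹^†_K`, the overconvergent elements of `E_K`. -/
noncomputable def EdagK : Subalgebra ℚ_[p] (Bt p) := EK p K ⊓ Overconvergent p

/-- The Robba ring `R_K = 𝔹^†_{rig, K}`, the union over `r` of the Fréchet completions of
`𝔹^{†, r}_K`, as a subring of `B̃^†_rig`. -/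
noncomputable def RobbaK : Subalgebra ℚ_[p] (Rig p) where
  carrier := {x | ∃ y : cauchyRig p, (∀ n, y.1 n ∈ EK p K) ∧ toRig p y = x}
  algebraMap_mem' c := ⟨algebraMap _ _ c, fun _ => algebraMap_mem (EK p K) c,
    (toRig p).commutes c⟩
  add_mem' := by
    rintro _ _ ⟨y, hy, rfl⟩ ⟨z, hz, rfl⟩
    exact ⟨y + z, fun n => add_mem (hy n) (hz n), map_add _ _ _⟩
  mul_mem' := by
    rintro _ _ ⟨y, hy, rfl⟩ ⟨z, hz, rfl⟩
    exact ⟨y * z, fun n => mul_mem (hy n) (hz n), map_mul _ _ _⟩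

theorem mem_RobbaK {x : Rig p} :
    x ∈ RobbaK p K ↔ ∃ y : cauchyRig p, (∀ n, y.1 n ∈ EK p K) ∧ toRig p y = x := Iff.rfl

theorem EK_stable : IsStableSubalgebra p (actBt p) K (EK p K) where
  frob_mem x hx := ⟨actBt_FontaineB p _ hx.1, fun h hh => by
    rw [← AlgHom.mul_apply, ← map_mul, frobS_comm, map_mul, AlgHom.mul_apply, hx.2 h hh]⟩
  gal_mem g hg x hx := ⟨actBt_FontaineB p _ hx.1, fun h hh => by
    have hn : (⟨g, hg⟩ : K.fixingSubgroup)⁻¹ * h * ⟨g, hg⟩ ∈ HK p K := by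
      have := (inferInstance : (HK p K).Normal).conj_mem h hh (⟨g, hg⟩ : K.fixingSubgroup)⁻¹
      rwa [inv_inv] at this
    have := hx.2 _ hn
    rw [← AlgHom.mul_apply, ← map_mul, ← map_mul]
    conv_rhs => rw [← this]
    rw [← AlgHom.mul_apply, ← map_mul, ← map_mul]
    congr 3
    simp [mul_assoc]⟩
  gal_eq h hh _ hx := hx.2 h hh

theorem EdagK_stable : IsStableSubalgebra p (actBt p) K (EdagK p K) where
  frob_mem x hx := ⟨(EK_stable p K).frob_mem x hx.1, actBt_Overconvergent p _ hx.2⟩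
  gal_mem g hg x hx := ⟨(EK_stable p K).gal_mem g hg x hx.1, actBt_Overconvergent p _ hx.2⟩
  gal_eq h hh _ hx := hx.1.2 h hh

theorem RobbaK_stable : IsStableSubalgebra p (actRig p) K (RobbaK p K) where
  frob_mem x hx := by
    rw [mem_RobbaK] at hx ⊢
    obtain ⟨y, hy, rfl⟩ := hx
    exact ⟨actSeq p (frobS p) y, fun n => (EK_stable p K).frob_mem _ (hy n), rfl⟩
  gal_mem g hg x hx := by
    rw [mem_RobbaK] at hx ⊢
    obtain ⟨y, hy, rfl⟩ := hx
    exact ⟨actSeq p (galS p g) y, fun n => (EK_stable p K).gal_mem g hg _ (hy n), rfl⟩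
  gal_eq h hh x hx := by
    rw [mem_RobbaK] at hx
    obtain ⟨y, hy, rfl⟩ := hx
    rw [actRig_toRig]
    exact congrArg (toRig p) (Subtype.ext (funext fun n => (EK_stable p K).gal_eq h hh _ (hy n)))

/-- The three types of coefficients. -/
inductive CoeffType
  /-- `E_K` -/
  | fontaine
  /-- `E†_K` -/
  | overconvergent
  /-- `R_K` -/
  | robba

/-- `E_K`, `E†_K` and `R_K` with their actions of `φ` and `Γ_K`. -/
noncomputable def coeffRing : CoeffType → PhiGammaRing p (GammaK p K)
  | .fontaine => stableRing p (actBt p) (EK_stable p K)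
  | .overconvergent => stableRing p (actBt p) (EdagK_stable p K)
  | .robba => stableRing p (actRig p) (RobbaK_stable p K)

variable {K L}

theorem EK_mono (h : K ≤ L) : EK p K ≤ EK p L := fun _ hx =>
  ⟨hx.1, fun g hg => hx.2 (galIncl p h g) hg⟩

theorem EdagK_mono (h : K ≤ L) : EdagK p K ≤ EdagK p L := inf_le_inf_right _ (EK_mono p h)

theorem RobbaK_mono (h : K ≤ L) : RobbaK p K ≤ RobbaK p L := by
  intro x hx
  rw [mem_RobbaK] at hx ⊢
  obtain ⟨y, hy, e⟩ := hx
  exact ⟨y, fun n => EK_mono p h (hy n), e⟩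

/-- The inclusions `E_K ⊆ E_L`, `E†_K ⊆ E†_L` and `R_K ⊆ R_L`. -/
noncomputable def coeffIncl (h : K ≤ L) : (S : CoeffType) →
    (coeffRing p K S).Hom (coeffRing p L S) (gammaIncl p h)
  | .fontaine => stableIncl p (actBt p) h (EK_stable p K) (EK_stable p L) (EK_mono p h)
  | .overconvergent =>
    stableIncl p (actBt p) h (EdagK_stable p K) (EdagK_stable p L) (EdagK_mono p h)
  | .robba => stableIncl p (actRig p) h (RobbaK_stable p K) (RobbaK_stable p L) (RobbaK_mono p h)

end Coefficients

end Rings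

/-!
Write `m = n + 1` for the index of `Γ_L Δ` in `Γ_K`.  Since `Γ_L` is open of finite index and `γ`
generates `Γ_K / Δ` topologically, `γ` generates the cyclic group `Γ_K / Γ_L Δ` of order `m`
(`isCyclicTransversal_of_dense`).  Everything else is formal: it holds for any coefficient rings
and any modules, along a homomorphism `ι : Γ' → Γ` with such a system `1, γ, …, γⁿ` of
representatives (`IsCyclicTransversal`).

A `Δ`-invariant `f` in `Ind D` is determined by its values at `1, γ, …, γⁿ`, which are arbitrary
elements of `D' = D^{Γ' ∩ Δ}` (`PhiGammaSpace.indInvariantsEquiv`).  In these terms `φ` acts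
componentwise, and `γ` shifts the values, with `f(γᵐ) = γ' f(1)`.  Let `const x` have the
values `x, …, x`, and `single x` the values `0, …, 0, x`.  As
`(γ - 1) const x = single ((γ' - 1) x)`, the maps
`x ↦ const x`, `(x, y) ↦ (single x, const y)`, `x ↦ single x`
form a morphism from the complex of `D` to the complex of `Ind D`.  The morphism
`f ↦ f(1)`, `(u, v) ↦ (∑ u(γⁱ), v(1))`, `w ↦ ∑ w(γⁱ)` in the other direction is a left inverse, and
a homotopy inverse because `u - single (∑ u(γⁱ))` is always in the image of `γ - 1`
(`PhiGammaSpace.exists_act'_sub_eq`).  Hence the first morphism induces isomorphisms on cohomology.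

It is natural in `D`, and it commutes with cup products already on cochains.  The only formula
which is not immediate is the one for the product of two `1`-cocycles: its term `x ⊗ γ' t`
corresponds to `single x ⊗ γ (const t)`, because `γ (const t)` has the value `γ' t` at `γⁿ`
(`PhiGammaSpace.indSingle_tmul'_act'`).
-/

/-! ### Elements of the induced module -/

section InducedModules

variable {p : ℕ} [Fact p.Prime] {Γ Γ' : Type} [CommGroup Γ] [CommGroup Γ']

/-- The powers `1, γ, …, γⁿ` represent every coset of `ι(Γ') Δ` in `Γ` exactly once, and
`ι(γ') ∈ γⁿ⁺¹ Δ`.  Thus `n + 1` is the index of `ι(Γ') Δ`. -/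
structure IsCyclicTransversal (ι : Γ' →* Γ) (Δ : Subgroup Γ) (γ : Γ) (γ' : Γ') (n : ℕ) : Prop where
  map_eq : ∃ δ ∈ Δ, ι γ' = γ ^ (n + 1) * δ
  exists_eq : ∀ g, ∃ h, ∃ δ ∈ Δ, ∃ i : Fin (n + 1), g = ι h * δ * γ ^ (i : ℕ)
  eq_of_eq : ∀ (i k : Fin (n + 1)) (h : Γ'), ∀ δ ∈ Δ, γ ^ (i : ℕ) = ι h * δ * γ ^ (k : ℕ) → i = k

namespace PhiGammaSpace

variable {R : PhiGammaRing p Γ} {R' : PhiGammaRing p Γ'} {ι : Γ' →* Γ}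
  (j : R.Hom R' ι) (D E : PhiGammaSpace.{u} R') (Δ : Subgroup Γ) (γ : Γ)

theorem act_one_apply (x : D.carrier) : D.act 1 x = x := by
  rw [map_one]; rfl

theorem act_mul_apply (g h : Γ') (x : D.carrier) : D.act (g * h) x = D.act g (D.act h x) := by
  rw [map_mul]; rfl

/-- The value of a `Δ`-invariant function at `γ ^ i`. -/
noncomputable def evalPow (i : ℕ) :
    (D.ind j).invariants Δ →ₗ[ℚ_[p]] D.invariants (Δ.comap ι) where
  toFun f := ⟨f.1.1 (γ ^ i), fun h hh => by
    rw [← f.1.2 h (γ ^ i), mul_comm]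
    exact congrFun (congrArg Subtype.val (f.2 (ι h) hh)) (γ ^ i)⟩
  map_add' f f' := rfl
  map_smul' c f := Subtype.ext (by
    change j.toAlgHom (R.act (γ ^ i) (algebraMap ℚ_[p] R.carrier c)) • f.1.1 (γ ^ i) =
      algebraMap ℚ_[p] R'.carrier c • f.1.1 (γ ^ i)
    rw [AlgHom.commutes, AlgHom.commutes])

theorem evalPow_act' (i : ℕ) (f : (D.ind j).invariants Δ) :
    evalPow j D Δ γ i ((D.ind j).act' Δ γ f) = evalPow j D Δ γ (i + 1) f :=
  Subtype.ext (congrArg f.1.1 (pow_succ γ i).symm)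

theorem evalPow_frob' (i : ℕ) (f : (D.ind j).invariants Δ) :
    evalPow j D Δ γ i ((D.ind j).frob' Δ f) = D.frob' _ (evalPow j D Δ γ i f) := rfl

theorem evalPow_ind_map' {D E : PhiGammaSpace.{u} R'} (a : Hom D E) (i : ℕ)
    (f : (D.ind j).invariants Δ) :
    evalPow j E Δ γ i ((a.ind j).map' Δ f) = a.map' _ (evalPow j D Δ γ i f) := rfl

theorem evalPow_indMul (i : ℕ) (f : (D.ind j).invariants Δ) (f' : (E.ind j).invariants Δ) :
    evalPow j (D.tensor E) Δ γ i ((indMul j D E).map' Δ (tmul' (D.ind j) (E.ind j) Δ f f')) =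
      tmul' D E _ (evalPow j D Δ γ i f) (evalPow j E Δ γ i f') := rfl

theorem ind_apply_mul_mul (f : (D.ind j).invariants Δ) (h : Γ') {δ : Γ} (hδ : δ ∈ Δ) (g : Γ) :
    f.1.1 (ι h * δ * g) = D.act h (f.1.1 g) := by
  rw [mul_assoc, f.1.2, mul_comm]
  exact congrArg (D.act h) (congrFun (congrArg Subtype.val (f.2 δ hδ)) g)

variable {Δ γ} {γ' : Γ'} {n : ℕ} (T : IsCyclicTransversal ι Δ γ γ' n)

include T

theorem evalPow_succ_last (f : (D.ind j).invariants Δ) :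
    evalPow j D Δ γ (n + 1) f = D.act' _ γ' (evalPow j D Δ γ 0 f) := by
  obtain ⟨δ, hδ, e⟩ := T.map_eq
  refine Subtype.ext ?_
  change f.1.1 (γ ^ (n + 1)) = D.act γ' (f.1.1 (γ ^ 0))
  rw [← D.ind_apply_mul_mul j Δ f γ' (inv_mem hδ), e, mul_inv_cancel_right, pow_zero, mul_one]

variable {j D} in
theorem ext_evalPow {f f' : (D.ind j).invariants Δ}
    (hf : ∀ i ≤ n, evalPow j D Δ γ i f = evalPow j D Δ γ i f') : f = f' := by
  refine Subtype.ext (Subtype.ext (funext fun g => ?_))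
  obtain ⟨h, δ, hδ, i, rfl⟩ := T.exists_eq g
  refine (D.ind_apply_mul_mul j Δ f h hδ _).trans
    (Eq.trans ?_ (D.ind_apply_mul_mul j Δ f' h hδ _).symm)
  exact congrArg (D.act h) (congrArg Subtype.val (hf i (Nat.lt_succ_iff.mp i.2)))

/-- The extension of a family of values at `1, γ, …, γⁿ` to `Γ` does not depend on the chosen
decompositions `g = ι(h) δ γⁱ`: two choices of `h` differ by an element of `ι⁻¹(Δ)`. -/
theorem act_eq_act (c : Fin (n + 1) → D.invariants (Δ.comap ι)) {h h' : Γ'} {δ δ' : Γ}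
    (hδ : δ ∈ Δ) (hδ' : δ' ∈ Δ) {i k : Fin (n + 1)}
    (e : ι h * δ * γ ^ (i : ℕ) = ι h' * δ' * γ ^ (k : ℕ)) :
    D.act h (c i) = D.act h' (c k) := by
  have hik : i = k := by
    refine T.eq_of_eq i k (h⁻¹ * h') (δ⁻¹ * δ') (mul_mem (inv_mem hδ) hδ') ?_
    rw [← mul_right_inj (ι h * δ), e, map_mul, map_inv]
    rw [show ι h * δ * ((ι h)⁻¹ * ι h' * (δ⁻¹ * δ') * γ ^ (k : ℕ)) =
      ι h * (ι h)⁻¹ * (δ * δ⁻¹) * (ι h' * δ' * γ ^ (k : ℕ)) by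
        simp only [mul_assoc, mul_comm, mul_left_comm]]
    simp
  subst hik
  have e' : ι (h'⁻¹ * h) = δ' * δ⁻¹ := by
    rw [map_mul, map_inv, inv_mul_eq_iff_eq_mul, ← mul_assoc, eq_mul_inv_iff_mul_eq]
    exact mul_right_cancel e
  have hc := (c i).2 (h'⁻¹ * h) (by
    rw [Subgroup.mem_comap, e']
    exact mul_mem hδ' (inv_mem hδ))
  conv_rhs => rw [← hc]
  rw [← act_mul_apply, mul_inv_cancel_left]

theorem exists_evalPow_eq (c : Fin (n + 1) → D.invariants (Δ.comap ι)) :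
    ∃ f : (D.ind j).invariants Δ, ∀ i : Fin (n + 1), evalPow j D Δ γ i f = c i := by
  choose h δ hδ i e using T.exists_eq
  have key : ∀ g (k : Γ'), ∀ ε ∈ Δ, ∀ l : Fin (n + 1), g = ι k * ε * γ ^ (l : ℕ) →
      D.act (h g) (c (i g)) = D.act k (c l) := fun g k ε hε l e' =>
    D.act_eq_act T c (hδ g) hε ((e g).symm.trans e')
  refine ⟨⟨⟨fun g => D.act (h g) (c (i g)), fun k g => ?_⟩, fun ε hε => ?_⟩, fun l => ?_⟩
  · rw [← act_mul_apply]
    refine key _ _ (δ g) (hδ g) _ ?_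
    conv_lhs => rw [e g]
    simp only [map_mul, mul_assoc]
  · refine Subtype.ext (funext fun g => ?_)
    change D.act (h (g * ε)) (c (i (g * ε))) = D.act (h g) (c (i g))
    refine key _ _ (δ g * ε) (mul_mem (hδ g) hε) _ ?_
    conv_lhs => rw [e g]
    simp only [mul_assoc, mul_comm, mul_left_comm]
  · refine Subtype.ext ?_
    change D.act (h (γ ^ (l : ℕ))) (c (i (γ ^ (l : ℕ)))) = c l
    rw [key _ 1 1 (one_mem _) l (by simp), act_one_apply]

/-- A `Δ`-invariant function in the induced module is the same as a family of `Γ' ∩ Δ`-invariant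
elements, its values at `1, γ, …, γⁿ`. -/
noncomputable def indInvariantsEquiv :
    (D.ind j).invariants Δ ≃ₗ[ℚ_[p]] (Fin (n + 1) → D.invariants (Δ.comap ι)) :=
  LinearEquiv.ofBijective (LinearMap.pi fun i : Fin (n + 1) => evalPow j D Δ γ i)
    ⟨fun _ _ hf => ext_evalPow T fun i hi => congrFun hf ⟨i, Nat.lt_succ_iff.mpr hi⟩,
      fun c => (exists_evalPow_eq j D T c).imp fun _ hf => funext hf⟩

theorem evalPow_symm (c : Fin (n + 1) → D.invariants (Δ.comap ι)) {i : ℕ} (hi : i ≤ n) :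
    evalPow j D Δ γ i ((indInvariantsEquiv j D T).symm c) = c ⟨i, Nat.lt_succ_iff.mpr hi⟩ :=
  congrFun ((indInvariantsEquiv j D T).apply_symm_apply c) ⟨i, Nat.lt_succ_iff.mpr hi⟩

/-- The function with the value `x` at each of `1, γ, …, γⁿ`. -/
noncomputable def indConst : D.invariants (Δ.comap ι) →ₗ[ℚ_[p]] (D.ind j).invariants Δ :=
  (indInvariantsEquiv j D T).symm.toLinearMap ∘ₗ LinearMap.pi fun _ => LinearMap.id

/-- The function with the value `x` at `γⁿ` and the value `0` at `1, γ, …, γⁿ⁻¹`. -/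
noncomputable def indSingle : D.invariants (Δ.comap ι) →ₗ[ℚ_[p]] (D.ind j).invariants Δ :=
  (indInvariantsEquiv j D T).symm.toLinearMap ∘ₗ
    LinearMap.single ℚ_[p] (fun _ => D.invariants (Δ.comap ι)) (Fin.last n)

theorem evalPow_indConst (x : D.invariants (Δ.comap ι)) {i : ℕ} (hi : i ≤ n) :
    evalPow j D Δ γ i (indConst j D T x) = x :=
  evalPow_symm j D T _ hi

theorem evalPow_indSingle (x : D.invariants (Δ.comap ι)) {i : ℕ} (hi : i ≤ n) :
    evalPow j D Δ γ i (indSingle j D T x) = if i = n then x else 0 := by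
  refine (evalPow_symm j D T _ hi).trans ?_
  rw [LinearMap.single_apply, Pi.single_apply]
  simp only [Fin.ext_iff, Fin.val_last]

theorem frob'_indConst (x : D.invariants (Δ.comap ι)) :
    (D.ind j).frob' Δ (indConst j D T x) = indConst j D T (D.frob' _ x) :=
  ext_evalPow T fun i hi => by
    rw [evalPow_frob', evalPow_indConst j D T x hi, evalPow_indConst j D T _ hi]

theorem frob'_indSingle (x : D.invariants (Δ.comap ι)) :
    (D.ind j).frob' Δ (indSingle j D T x) = indSingle j D T (D.frob' _ x) :=
  ext_evalPow T fun i hi => by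
    rw [evalPow_frob', evalPow_indSingle j D T x hi, evalPow_indSingle j D T _ hi,
      apply_ite (D.frob' _), map_zero]

theorem evalPow_act'_indConst (x : D.invariants (Δ.comap ι)) {i : ℕ} (hi : i ≤ n) :
    evalPow j D Δ γ i ((D.ind j).act' Δ γ (indConst j D T x)) =
      if i = n then D.act' _ γ' x else x := by
  rw [evalPow_act']
  split_ifs with h
  · rw [h, evalPow_succ_last j D T, evalPow_indConst j D T x (Nat.zero_le n)]
  · exact evalPow_indConst j D T x (by omega)

theorem act'_indConst_sub (x : D.invariants (Δ.comap ι)) :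
    (D.ind j).act' Δ γ (indConst j D T x) - indConst j D T x =
      indSingle j D T (D.act' _ γ' x - x) :=
  ext_evalPow T fun i hi => by
    rw [map_sub, evalPow_act'_indConst j D T x hi, evalPow_indConst j D T x hi,
      evalPow_indSingle j D T _ hi]
    split_ifs
    · rfl
    · exact sub_self x

/-- If `γ f - f` is supported at `γⁿ`, then `f` is constant on `1, γ, …, γⁿ`. -/
theorem eq_indConst {f : (D.ind j).invariants Δ} {x : D.invariants (Δ.comap ι)}
    (hf : (D.ind j).act' Δ γ f - f = indSingle j D T x) :
    f = indConst j D T (evalPow j D Δ γ 0 f) := by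
  refine ext_evalPow T fun i hi => ?_
  rw [evalPow_indConst j D T _ hi]
  induction i with
  | zero => rfl
  | succ i ih =>
    have h := congrArg (evalPow j D Δ γ i) hf
    rw [map_sub, evalPow_act', evalPow_indSingle j D T x (by omega), if_neg (by omega),
      sub_eq_zero] at h
    rw [h, ih (by omega)]

omit T in
variable (Δ γ) in
/-- The sum of the values at `1, γ, …, γᵏ⁻¹`. -/
noncomputable def partialTrace (k : ℕ) :
    (D.ind j).invariants Δ →ₗ[ℚ_[p]] D.invariants (Δ.comap ι) :=
  ∑ i ∈ Finset.range k, evalPow j D Δ γ i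

omit T in
theorem partialTrace_apply (k : ℕ) (f : (D.ind j).invariants Δ) :
    partialTrace j D Δ γ k f = ∑ i ∈ Finset.range k, evalPow j D Δ γ i f :=
  LinearMap.sum_apply _ _ _

omit T in
theorem partialTrace_frob' (k : ℕ) (f : (D.ind j).invariants Δ) :
    partialTrace j D Δ γ k ((D.ind j).frob' Δ f) = D.frob' _ (partialTrace j D Δ γ k f) := by
  simp only [partialTrace_apply, evalPow_frob', map_sum]

/-- The sum of the values of `γ f - f` telescopes. -/
theorem trace_act'_sub (f : (D.ind j).invariants Δ) :
    partialTrace j D Δ γ (n + 1) ((D.ind j).act' Δ γ f - f) =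
      D.act' _ γ' (evalPow j D Δ γ 0 f) - evalPow j D Δ γ 0 f := by
  rw [partialTrace_apply, ← evalPow_succ_last j D T]
  simp only [map_sub, evalPow_act']
  exact Finset.sum_range_sub (fun i => evalPow j D Δ γ i f) (n + 1)

theorem trace_indSingle (x : D.invariants (Δ.comap ι)) :
    partialTrace j D Δ γ (n + 1) (indSingle j D T x) = x := by
  rw [partialTrace_apply, Finset.sum_congr rfl fun i hi =>
    evalPow_indSingle j D T x (Nat.lt_succ_iff.mp (Finset.mem_range.mp hi))]
  simp

/-- Modulo `γ - 1`, every function is supported at `γⁿ`. -/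
theorem exists_act'_sub_eq (u : (D.ind j).invariants Δ) :
    ∃ f : (D.ind j).invariants Δ, (D.ind j).act' Δ γ f - f =
      u - indSingle j D T (partialTrace j D Δ γ (n + 1) u) := by
  obtain ⟨f, hf⟩ := exists_evalPow_eq j D T fun i => partialTrace j D Δ γ i u
  have hf' : ∀ i ≤ n, evalPow j D Δ γ i f = partialTrace j D Δ γ i u :=
    fun i hi => hf ⟨i, Nat.lt_succ_iff.mpr hi⟩
  have h0 : evalPow j D Δ γ 0 f = 0 := by
    rw [hf' 0 (Nat.zero_le n), partialTrace_apply, Finset.sum_range_zero]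
  refine ⟨f, ext_evalPow T fun i hi => ?_⟩
  rw [map_sub, map_sub, evalPow_act', evalPow_indSingle j D T _ hi, hf' i hi]
  split_ifs with h
  · rw [h, evalPow_succ_last j D T, h0, map_zero, partialTrace_apply, partialTrace_apply,
      Finset.sum_range_succ]
    abel
  · rw [hf' (i + 1) (by omega), partialTrace_apply, partialTrace_apply, Finset.sum_range_succ]
    abel

theorem indConst_natural {D E : PhiGammaSpace.{u} R'} (a : Hom D E)
    (x : D.invariants (Δ.comap ι)) :
    indConst j E T (a.map' _ x) = (a.ind j).map' Δ (indConst j D T x) :=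
  ext_evalPow T fun i hi => by
    rw [evalPow_ind_map', evalPow_indConst j D T x hi, evalPow_indConst j E T _ hi]

theorem indSingle_natural {D E : PhiGammaSpace.{u} R'} (a : Hom D E)
    (x : D.invariants (Δ.comap ι)) :
    indSingle j E T (a.map' _ x) = (a.ind j).map' Δ (indSingle j D T x) :=
  ext_evalPow T fun i hi => by
    rw [evalPow_ind_map', evalPow_indSingle j D T x hi, evalPow_indSingle j E T _ hi,
      apply_ite (a.map' _), map_zero]

theorem indConst_tmul' (x : D.invariants (Δ.comap ι)) (y : E.invariants (Δ.comap ι)) :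
    indConst j (D.tensor E) T (tmul' D E _ x y) = (indMul j D E).map' Δ
      (tmul' (D.ind j) (E.ind j) Δ (indConst j D T x) (indConst j E T y)) :=
  ext_evalPow T fun i hi => by
    rw [evalPow_indMul, evalPow_indConst j D T x hi, evalPow_indConst j E T y hi,
      evalPow_indConst j _ T _ hi]

theorem indSingle_tmul' (x : D.invariants (Δ.comap ι)) (y : E.invariants (Δ.comap ι)) :
    indSingle j (D.tensor E) T (tmul' D E _ x y) = (indMul j D E).map' Δ
      (tmul' (D.ind j) (E.ind j) Δ (indConst j D T x) (indSingle j E T y)) :=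
  ext_evalPow T fun i hi => by
    rw [evalPow_indMul, evalPow_indConst j D T x hi, evalPow_indSingle j E T y hi,
      evalPow_indSingle j _ T _ hi, apply_ite (tmul' D E _ x), map_zero]

/-- The factor `γ'` comes from the value of a translate by `γ` at `γⁿ`. -/
theorem indSingle_tmul'_act' (x : D.invariants (Δ.comap ι)) (y : E.invariants (Δ.comap ι)) :
    indSingle j (D.tensor E) T (tmul' D E _ x (E.act' _ γ' y)) = (indMul j D E).map' Δ
      (tmul' (D.ind j) (E.ind j) Δ (indSingle j D T x)
        ((E.ind j).act' Δ γ (indConst j E T y))) :=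
  ext_evalPow T fun i hi => by
    rw [evalPow_indMul, evalPow_act'_indConst j E T y hi, evalPow_indSingle j D T x hi,
      evalPow_indSingle j _ T _ hi]
    split_ifs
    · rfl
    · rw [map_zero, LinearMap.zero_apply]

/-! ### The Shapiro maps -/

theorem d₁_indConst (x : D.invariants (Δ.comap ι)) :
    (D.ind j).d₁ Δ γ (indConst j D T x) =
      ((indSingle j D T).prodMap (indConst j D T)) (D.d₁ _ γ' x) := by
  rw [d₁_apply, d₁_apply, act'_indConst_sub, frob'_indConst, ← map_sub]
  rfl

theorem d₂_prodMap (c : D.invariants (Δ.comap ι) × D.invariants (Δ.comap ι)) :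
    (D.ind j).d₂ Δ γ (((indSingle j D T).prodMap (indConst j D T)) c) =
      indSingle j D T (D.d₂ _ γ' c) := by
  rw [d₂_apply, d₂_apply, LinearMap.prodMap_apply, act'_indConst_sub, frob'_indSingle,
    ← map_sub, ← map_sub]

/-- The Shapiro map in degree `0`, induced by `indConst`. -/
noncomputable def shapiro0 : D.H0 (Δ.comap ι) γ' →ₗ[ℚ_[p]] (D.ind j).H0 Δ γ :=
  (indConst j D T).restrict fun x hx => by
    rw [LinearMap.mem_ker] at hx ⊢
    rw [d₁_indConst, hx, map_zero]

/-- The Shapiro map on `1`-cocycles: on the component of `γ` it is `indSingle`, on the component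
of `φ` it is `indConst`. -/
noncomputable def shapiroZ1 : D.Z1 (Δ.comap ι) γ' →ₗ[ℚ_[p]] (D.ind j).Z1 Δ γ :=
  ((indSingle j D T).prodMap (indConst j D T)).restrict fun x hx => by
    rw [LinearMap.mem_ker] at hx ⊢
    rw [d₂_prodMap, hx, map_zero]

/-- The Shapiro map in degree `1`, induced by `shapiroZ1`. -/
noncomputable def shapiro1 : D.H1 (Δ.comap ι) γ' →ₗ[ℚ_[p]] (D.ind j).H1 Δ γ :=
  Submodule.mapQ _ _ (shapiroZ1 j D T) (by
    rintro x ⟨y, hy⟩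
    exact ⟨indConst j D T y, by rw [d₁_indConst, hy]; rfl⟩)

/-- The Shapiro map in degree `2`, induced by `indSingle`. -/
noncomputable def shapiro2 : D.H2 (Δ.comap ι) γ' →ₗ[ℚ_[p]] (D.ind j).H2 Δ γ :=
  Submodule.mapQ _ _ (indSingle j D T) (by
    rintro x ⟨y, rfl⟩
    exact ⟨_, d₂_prodMap j D T y⟩)

theorem shapiro0_bijective : Function.Bijective (shapiro0 j D T) := by
  refine ⟨fun x y h => Subtype.ext ?_, fun f => ?_⟩
  · have h' := congrArg (evalPow j D Δ γ 0) (congrArg Subtype.val h)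
    exact ((evalPow_indConst j D T x.1 n.zero_le).symm.trans h').trans
      (evalPow_indConst j D T y.1 n.zero_le)
  · obtain ⟨h1, h2⟩ := (D.ind j).mem_H0 Δ γ f.2
    refine ⟨⟨evalPow j D Δ γ 0 f.1, ?_⟩, Subtype.ext (eq_indConst j D T (x := 0) ?_).symm⟩
    · rw [LinearMap.mem_ker, d₁_apply, ← trace_act'_sub j D T, h1, sub_self, map_zero,
        ← evalPow_frob', h2, sub_self]
      rfl
    · rw [h1, sub_self, map_zero]

theorem shapiro1_bijective : Function.Bijective (shapiro1 j D T) := by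
  refine ⟨(injective_iff_map_eq_zero _).mpr fun x hx => ?_, fun x => ?_⟩
  · obtain ⟨⟨⟨u, v⟩, huv⟩, rfl⟩ := Submodule.mkQ_surjective _ x
    -- if the image of `(u, v)` is the coboundary of `f`, then `(u, v)` is that of `f(1)`
    obtain ⟨f, hf⟩ := (Submodule.Quotient.mk_eq_zero _).mp hx
    have hf : ((D.ind j).act' Δ γ f - f, (D.ind j).frob' Δ f - f) =
      (indSingle j D T u, indConst j D T v) := hf
    rw [Prod.mk.injEq] at hf
    refine (Submodule.Quotient.mk_eq_zero _).mpr ⟨evalPow j D Δ γ 0 f, ?_⟩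
    change _ = (u, v)
    rw [d₁_apply, ← trace_act'_sub j D T, hf.1, trace_indSingle, ← evalPow_frob', ← map_sub,
      hf.2, evalPow_indConst j D T v n.zero_le]
  · obtain ⟨⟨⟨u, v⟩, huv⟩, rfl⟩ := Submodule.mkQ_surjective _ x
    obtain ⟨f, hf⟩ := exists_act'_sub_eq j D T u
    -- after subtracting the coboundary of `f`, the component of `γ` is supported at `γⁿ`
    have hc : ((D.ind j).frob' Δ (indSingle j D T (partialTrace j D Δ γ (n + 1) u)) -
        indSingle j D T (partialTrace j D Δ γ (n + 1) u)) =
        (D.ind j).act' Δ γ (v - ((D.ind j).frob' Δ f - f)) -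
          (v - ((D.ind j).frob' Δ f - f)) := by
      have h0 : indSingle j D T (partialTrace j D Δ γ (n + 1) u) =
          u - ((D.ind j).act' Δ γ f - f) := by rw [hf]; abel
      rw [LinearMap.mem_ker, d₂_apply, sub_eq_zero] at huv
      rw [h0]
      simp only [map_sub, act'_frob'] at huv ⊢
      refine sub_eq_zero.mp (Eq.trans ?_ (sub_eq_zero.mpr huv))
      abel
    have hv := eq_indConst j D T (hc.symm.trans
      ((congrArg (· - _) (frob'_indSingle j D T _)).trans (map_sub _ _ _).symm))
    set t := partialTrace j D Δ γ (n + 1) u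
    set w := evalPow j D Δ γ 0 (v - ((D.ind j).frob' Δ f - f))
    have hz : (t, w) ∈ LinearMap.ker (D.d₂ (Δ.comap ι) γ') := by
      have := congrArg (partialTrace j D Δ γ (n + 1)) hc
      rw [frob'_indSingle, ← map_sub, trace_indSingle, trace_act'_sub j D T] at this
      rw [LinearMap.mem_ker, d₂_apply, this, sub_self]
    refine ⟨Submodule.Quotient.mk ⟨(t, w), hz⟩, (Submodule.Quotient.eq _).mpr ⟨-f, ?_⟩⟩
    change _ = (indSingle j D T t, indConst j D T w) - (u, v)
    rw [map_neg, d₁_apply, hf, ← hv, Prod.neg_mk, Prod.mk_sub_mk]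
    refine Prod.ext ?_ ?_ <;> dsimp only <;> abel

theorem shapiro2_bijective : Function.Bijective (shapiro2 j D T) := by
  refine ⟨(injective_iff_map_eq_zero _).mpr fun x hx => ?_, fun x => ?_⟩
  · obtain ⟨x, rfl⟩ := Submodule.mkQ_surjective _ x
    obtain ⟨c, hc⟩ := (Submodule.Quotient.mk_eq_zero _).mp hx
    refine (Submodule.Quotient.mk_eq_zero _).mpr
      ⟨(partialTrace j D Δ γ (n + 1) c.1, evalPow j D Δ γ 0 c.2), ?_⟩
    rw [← trace_indSingle j D T x, ← hc, d₂_apply, d₂_apply, map_sub _ (_ - _), map_sub,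
      trace_act'_sub j D T, partialTrace_frob']
  · obtain ⟨w, rfl⟩ := Submodule.mkQ_surjective _ x
    obtain ⟨f, hf⟩ := exists_act'_sub_eq j D T w
    refine ⟨Submodule.Quotient.mk (partialTrace j D Δ γ (n + 1) w),
      (Submodule.Quotient.eq _).mpr ⟨(0, f), ?_⟩⟩
    rw [d₂_apply, hf, map_zero, sub_self, zero_sub, neg_sub]

/-- Shapiro's lemma for induction along `ι`.  Naturality and compatibility
with cup products hold already on cochains. -/
noncomputable def shapiroIsomorphisms (P : PhiGammaSpace.{u} R' → Prop)
    (hP : ∀ D E, P D → P E → P (D.tensor E)) : ShapiroIsomorphisms j Δ γ γ' P hP where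
  iso0 D _ := LinearEquiv.ofBijective _ (shapiro0_bijective j D T)
  iso1 D _ := LinearEquiv.ofBijective _ (shapiro1_bijective j D T)
  iso2 D _ := LinearEquiv.ofBijective _ (shapiro2_bijective j D T)
  natural0 _ _ _ _ a x := Subtype.ext (indConst_natural j T a x.1)
  natural1 D E _ _ a x := by
    obtain ⟨x, rfl⟩ := Submodule.mkQ_surjective _ x
    exact congrArg (Submodule.Quotient.mk (p := (E.ind j).B1 Δ γ)) (Subtype.ext
      (Prod.ext (indSingle_natural j T a x.1.1) (indConst_natural j T a x.1.2)))
  natural2 D E _ _ a x := by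
    obtain ⟨x, rfl⟩ := Submodule.mkQ_surjective _ x
    exact congrArg (Submodule.Quotient.mk (p := LinearMap.range ((E.ind j).d₂ Δ γ)))
      (indSingle_natural j T a x)
  cup00 D E _ _ x y := Subtype.ext (indConst_tmul' j D E T x.1 y.1)
  cup01 D E _ _ x y := by
    obtain ⟨y, rfl⟩ := Submodule.mkQ_surjective _ y
    exact congrArg (Submodule.Quotient.mk (p := ((D.tensor E).ind j).B1 Δ γ)) (Subtype.ext
      (Prod.ext (indSingle_tmul' j D E T x.1 y.1.1) (indConst_tmul' j D E T x.1 y.1.2)))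
  cup02 D E _ _ x y := by
    obtain ⟨y, rfl⟩ := Submodule.mkQ_surjective _ y
    exact congrArg (Submodule.Quotient.mk (p := LinearMap.range (((D.tensor E).ind j).d₂ Δ γ)))
      (indSingle_tmul' j D E T x.1 y)
  cup11 D E _ _ x y := by
    obtain ⟨x, rfl⟩ := Submodule.mkQ_surjective _ x
    obtain ⟨y, rfl⟩ := Submodule.mkQ_surjective _ y
    refine congrArg (Submodule.Quotient.mk (p := LinearMap.range (((D.tensor E).ind j).d₂ Δ γ)))
      (?_ : indSingle j (D.tensor E) T (cup11Z D E _ γ' x y) = (indMul j D E).map' Δ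
        (cup11Z (D.ind j) (E.ind j) Δ γ (shapiroZ1 j D T x) (shapiroZ1 j E T y)))
    rw [cup11Z_apply, cup11Z_apply, map_sub, map_sub, indSingle_tmul', indSingle_tmul'_act',
      ← frob'_indSingle]
    rfl

end PhiGammaSpace

end InducedModules

/-! ### Cosets in `Γ_K` -/

section Transversals

/-- If `ι(Γ')` is open of finite index and `γ` generates `Γ / Δ` topologically, then `γ` generates
the finite discrete group `Γ / ι(Γ') Δ`. -/
theorem isCyclicTransversal_of_dense {Γ Γ' : Type} [CommGroup Γ] [CommGroup Γ']
    [TopologicalSpace Γ] [SeparatelyContinuousMul Γ] {ι : Γ' →* Γ} {Δ : Subgroup Γ} {γ : Γ}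
    {γ' : Γ'}
    (hopen : IsOpen (ι.range : Set Γ)) (hfin : ι.range.FiniteIndex)
    (hγ : Dense (Subgroup.closure (insert γ (Δ : Set Γ)) : Set Γ))
    (hγ' : ∃ δ ∈ Δ, ι γ' = γ ^ (ι.range ⊔ Δ).index * δ) :
    ∃ n, IsCyclicTransversal ι Δ γ γ' n := by
  have hHopen : IsOpen ((ι.range ⊔ Δ : Subgroup Γ) : Set Γ) :=
    Subgroup.isOpen_mono le_sup_left hopen
  have hHfin : (ι.range ⊔ Δ).FiniteIndex := Subgroup.finiteIndex_of_le le_sup_left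
  obtain ⟨n, hn⟩ := Nat.exists_eq_succ_of_ne_zero hHfin.index_ne_zero
  have hgen : ∀ q, q ∈ Subgroup.zpowers (QuotientGroup.mk' (ι.range ⊔ Δ) γ) := by
    intro q
    obtain ⟨g, rfl⟩ := QuotientGroup.mk'_surjective _ q
    obtain ⟨s, hs, hgs⟩ := hγ.exists_mem_open (hHopen.preimage (continuous_const_mul g⁻¹))
      ⟨g, by simp⟩
    have hle : Subgroup.closure (insert γ (Δ : Set Γ)) ≤
        (Subgroup.zpowers (QuotientGroup.mk' (ι.range ⊔ Δ) γ)).comap (QuotientGroup.mk' _) := by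
      rw [Subgroup.closure_le, Set.insert_subset_iff]
      refine ⟨Subgroup.mem_zpowers _, fun δ hδ => ?_⟩
      have h1 : QuotientGroup.mk' (ι.range ⊔ Δ) δ = 1 :=
        (QuotientGroup.eq_one_iff δ).mpr (Subgroup.mem_sup_right hδ)
      rw [SetLike.mem_coe, Subgroup.mem_comap, h1]
      exact one_mem _
    rw [show QuotientGroup.mk' (ι.range ⊔ Δ) g = QuotientGroup.mk' _ s from
      QuotientGroup.eq.mpr hgs]
    exact hle hs
  have hord : orderOf (QuotientGroup.mk' (ι.range ⊔ Δ) γ) = n + 1 :=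
    (orderOf_eq_card_of_forall_mem_zpowers hgen).trans hn
  refine ⟨n, by rwa [hn] at hγ', fun g => ?_, fun i k h δ hδ e => ?_⟩
  · obtain ⟨i, hi⟩ := (isOfFinOrder_iff_pow_eq_one.mpr ⟨n + 1, n.succ_pos,
      hord ▸ pow_orderOf_eq_one _⟩).mem_powers_iff_mem_zpowers.mpr (hgen (QuotientGroup.mk' _ g))
    have hi' : QuotientGroup.mk' (ι.range ⊔ Δ) (γ ^ (i % (n + 1))) = QuotientGroup.mk' _ g := by
      rw [map_pow, ← hord, pow_mod_orderOf]
      exact hi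
    obtain ⟨_, ⟨h, rfl⟩, δ, hδ, e⟩ := Subgroup.mem_sup.mp (QuotientGroup.eq.mp hi')
    exact ⟨h, δ, hδ, ⟨i % (n + 1), Nat.mod_lt _ n.succ_pos⟩,
      by rw [e, mul_comm, mul_inv_cancel_left]⟩
  · have hik : QuotientGroup.mk' (ι.range ⊔ Δ) γ ^ (i : ℕ) = QuotientGroup.mk' _ γ ^ (k : ℕ) := by
      have h1 : QuotientGroup.mk' (ι.range ⊔ Δ) (ι h * δ) = 1 :=
        (QuotientGroup.eq_one_iff _).mpr (Subgroup.mul_mem_sup ⟨h, rfl⟩ hδ)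
      rw [← map_pow, e, map_mul, h1, one_mul, map_pow]
    rw [pow_eq_pow_iff_modEq, hord] at hik
    exact Fin.ext (Nat.ModEq.eq_of_lt_of_lt hik i.2 k.2)

variable (p : ℕ) [Fact p.Prime] {K L : IntermediateField ℚ_[p] (PadicAlgCl p)}

theorem range_gammaIncl (h : K ≤ L) : (gammaIncl p h).range =
    (L.fixingSubgroup.subgroupOf K.fixingSubgroup).map (QuotientGroup.mk' (HK p K)) := by
  ext x
  constructor
  · rintro ⟨y, rfl⟩
    obtain ⟨g, rfl⟩ := QuotientGroup.mk_surjective y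
    exact ⟨galIncl p h g, g.2, rfl⟩
  · rintro ⟨g, hg, rfl⟩
    exact ⟨QuotientGroup.mk ⟨g.1, hg⟩, rfl⟩

theorem isOpen_range_gammaIncl [FiniteDimensional ℚ_[p] L] (h : K ≤ L) :
    IsOpen ((gammaIncl p h).range : Set (GammaK p K)) := by
  rw [range_gammaIncl]
  exact QuotientGroup.isOpenMap_coe _ (L.fixingSubgroup_isOpen.preimage continuous_subtype_val)

theorem finiteIndex_range_gammaIncl [FiniteDimensional ℚ_[p] L] (h : K ≤ L) :
    (gammaIncl p h).range.FiniteIndex := by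
  have hL : L.fixingSubgroup.FiniteIndex := ⟨by
    rw [← IntermediateField.finrank_eq_fixingSubgroup_index]
    exact Module.finrank_pos.ne'⟩
  rw [range_gammaIncl]
  exact ⟨fun h0 => (inferInstance : (L.fixingSubgroup.subgroupOf K.fixingSubgroup).FiniteIndex).1
    (Nat.eq_zero_of_zero_dvd
      (h0 ▸ Subgroup.index_map_dvd _ (QuotientGroup.mk'_surjective (HK p K))))⟩

end Transversals

theorem theorem2p2 (p : ℕ) [Fact p.Prime] (K L : IntermediateField ℚ_[p] (PadicAlgCl p))
    [FiniteDimensional ℚ_[p] K] [FiniteDimensional ℚ_[p] L] (hKL : K ≤ L)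
    (Δ : Subgroup (GammaK p K)) [Finite Δ] (γ : GammaK p K)
    (hγ : Dense (Subgroup.closure (insert γ (Δ : Set (GammaK p K))) : Set (GammaK p K)))
    (γ' : GammaK p L)
    (hγ' : ∃ δ ∈ Δ, gammaIncl p hKL γ' = γ ^ ((gammaIncl p hKL).range ⊔ Δ).index * δ) :
    (∀ S : CoeffType, Nonempty (ShapiroIsomorphisms.{u} (coeffIncl p hKL S) Δ γ γ'
      PhiGammaSpace.IsPhiGammaModule (fun _ _ => .tensor))) ∧
    Nonempty (ShapiroIsomorphisms.{u} (coeffIncl p hKL .robba) Δ γ γ'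
      PhiGammaSpace.IsGeneralizedPhiGammaModule (fun _ _ => .tensor)) := by
  obtain ⟨n, T⟩ := isCyclicTransversal_of_dense (isOpen_range_gammaIncl p hKL)
    (finiteIndex_range_gammaIncl p hKL) hγ hγ'
  exact ⟨fun S => ⟨PhiGammaSpace.shapiroIsomorphisms _ T _ _⟩,
    ⟨PhiGammaSpace.shapiroIsomorphisms _ T _ _⟩⟩
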